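/- All manifolds are smooth, finite-dimensional, Hausdorff, second countable and without boundary. Let $M$ be a manifold on which a Lie group $G$ (with Lie algebra $\mathfrak g$) acts smoothly, from the left, and transitively, and let $\Sigma$ be a connected manifold. Brackets on $\mathfrak g$ are defined by right-invariant vector fields, and $\xi^\dagger$ denotes the infinitesimal generator on $M$ of $\xi\in\mathfrak g$. A *symmetry* of $M$ is a diffeomorphism $\phi:M\to M$ for which there is some $l\in G$ with $\phi(g\cdot m)=lgl^{-1}\cdot\phi(m)$ for all $g\in G$, $m\in M$; the set of symmetries is denoted $\mathrm{Aut}(M)$. A *Maurer–Cartan form* is a Lie algebroid morphism $\omega:A\to\mathfrak g$, for some Lie algebroid $A$ over $\Sigma$, such that $A$ is transitive, $\omega$ is injective on every isotropy algebra $A_x$ (the kernel of the anchor at $x$), and for some $x_0\in\Sigma$, $m_0\in M$ one has $\omega(A_{x_0})\subset\mathfrak g_{m_0}=\{\xi:\xi^\dagger(m_0)=0\}$. A morphism from $\omega_1:A_1\to\mathfrak g$ to $\omega_2:A_2\to\mathfrak g$ is a pair $(\lambda,l)$ of a Lie algebroid morphism $\lambda:A_1\to A_2$ covering $\mathrm{id}_\Sigma$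 and an element $l\in G$ with $\omega_2\circ\lambda=\mathrm{Ad}_l\circ\omega_1$. Maurer–Cartan forms and these morphisms form a category. For a smooth map $f:\Sigma\to M$ let $A(f)$ be the pullback along $f$ of the action algebroid $\mathfrak g\times M$: its fibre over $x$ is $\{(\xi,v)\in\mathfrak g\times T_x\Sigma:\xi^\dagger(f(x))=T_xf(v)\}$, its anchor is $(\xi,v)\mapsto v$, and its bracket is $$[(X,v),(Y,w)]=\bigl(v\cdot Y-w\cdot X+\{X,Y\},\,[v,w]\bigr),\qquad \{X,Y\}(x)=[X(x),Y(x)]_{\mathfrak g}.$$ The *logarithmic derivative* $\delta f:A(f)\to\mathfrak g$, $(\xi,v)\mapsto\xi$, is a Maurer–Cartan form. **Proposition 2.5.** Let $f_1,f_2:\Sigma\to M$ be smooth maps with $f_2=\phi\circ f_1$ for some $\phi\in\mathrm{Aut}(M)$. Then $\delta f_1$ and $\delta f_2$ are isomorphic in the category of Maurer–Cartan forms. Moreover, for every $l\in G$ with $\phi(g\cdot m)=lgl^{-1}\cdot\phi(m)$ for all $g\in G$, $m\in M$, there is such an isomorphism $(\lambda,l):\delta f_1\to\delta f_2$ that is induced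 by $\mathrm{Ad}_l\times\phi$ on $\mathfrak g\times M$, i.e. the natural maps $A(f_i)\to\mathfrak g\times M$, given on the fibre over $x$ by $(\xi,v)\mapsto(\xi,f_i(x))$, intertwine $\lambda$ with $\mathrm{Ad}_l\times\phi$. -/

import Mathlib

open Bundle Set Filter Topology VectorField
open scoped Manifold ContDiff

/-! # Logarithmic derivatives of maps into Klein geometries

All manifolds are smooth, finite dimensional and without boundary, modelled on normed spaces `EG`,
`EM`, `ES`. The Lie algebra `𝔤 = T₁G` of `G` is the model space `EG` (this is Mathlib's definition
of the tangent space), with the bracket of right-invariant vector fields.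

The definitions are: `infGen` (infinitesimal action), `bracketR` (bracket of `𝔤`), `Ad`,
`LieAlgebroid` and `LieAlgebroid.Hom`, `MCForm`, `MCForm.Hom` and the category structure,
`pullbackFiber` (fibres of `A(f)`), `pullbackBracket`, `pullbackAlgebroid` (the algebroid `A(f)`),
`logarithmicDerivative` (`δf`), `IsSymmetryBy`, `IsSymmetry`, `toAction`.

Everything else is proved here only because these definitions need it: a family of kernels of
surjections is a smooth subbundle (`KernelBundle`), the differential of a function along a Lie
bracket (`mvfderiv_mlieBracket`), closure of sections of `A(f)` under the bracket
(`mfderiv_mlieBracket`), a transitive action is infinitesimally transitive (`infGen_surjective`, so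
that `A(f)` has constant rank and is transitive), and the Jacobi identity. -/

/-! ## Smooth vector bundles cut out by local equations -/

namespace KernelBundle

set_option linter.unusedSectionVars false

variable {EB : Type*} [NormedAddCommGroup EB] [NormedSpace ℝ EB]
  {B : Type*} [TopologicalSpace B] [ChartedSpace EB B]
  {F₀ : Type*} [NormedAddCommGroup F₀] [NormedSpace ℝ F₀] [CompleteSpace F₀]
  {V : B → Type*} [∀ x, AddCommGroup (V x)] [∀ x, Module ℝ (V x)]
  [TopologicalSpace (TotalSpace F₀ V)] [∀ x, TopologicalSpace (V x)]
  [FiberBundle F₀ V] [VectorBundle ℝ F₀ V]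
  {W : Type*} [NormedAddCommGroup W] [NormedSpace ℝ W]
  {F : Type*} [NormedAddCommGroup F] [NormedSpace ℝ F]

/-- Local linear coordinates near `x₀` on a vector bundle `V`, the first component of which cuts out
the family of subspaces `K x ⊆ V x`. -/
structure Chart (F₀ W F : Type*) [NormedAddCommGroup F₀] [NormedSpace ℝ F₀]
    [TopologicalSpace (TotalSpace F₀ V)] [FiberBundle F₀ V] [VectorBundle ℝ F₀ V]
    [NormedAddCommGroup W] [NormedSpace ℝ W] [NormedAddCommGroup F] [NormedSpace ℝ F]
    (K : ∀ x, Submodule ℝ (V x)) (x₀ : B) where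
  U : Set B
  isOpen : IsOpen U
  mem : x₀ ∈ U
  sub : U ⊆ (trivializationAt F₀ V x₀).baseSet
  Φ : B → F₀ →L[ℝ] (W × F)
  smooth : ContMDiffOn 𝓘(ℝ, EB) 𝓘(ℝ, F₀ →L[ℝ] (W × F)) ∞ Φ U
  inv : ∀ x ∈ U, (Φ x).IsInvertible
  spec : ∀ x ∈ U, ∀ v : V x,
    v ∈ K x ↔ (Φ x ((trivializationAt F₀ V x₀).continuousLinearMapAt ℝ x v)).1 = 0

variable {K : ∀ x, Submodule ℝ (V x)}

namespace Chart
variable {x₀ : B} (c : Chart (EB := EB) F₀ W F K x₀)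

/-- The coordinate map of the subbundle. -/
noncomputable def fwd (x : B) : V x →ₗ[ℝ] F :=
  (LinearMap.snd ℝ W F) ∘ₗ (c.Φ x : F₀ →ₗ[ℝ] (W × F)) ∘ₗ
    ((trivializationAt F₀ V x₀).continuousLinearMapAt ℝ x : V x →ₗ[ℝ] F₀)

/-- The inverse of the coordinate map. -/
noncomputable def bwd (x : B) : F →ₗ[ℝ] V x :=
  ((trivializationAt F₀ V x₀).symmL ℝ x : F₀ →ₗ[ℝ] V x) ∘ₗ
    ((c.Φ x).inverse : (W × F) →ₗ[ℝ] F₀) ∘ₗ (LinearMap.inr ℝ W F)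

theorem fwd_apply (x : B) (v : V x) : c.fwd x v =
    (c.Φ x ((trivializationAt F₀ V x₀).continuousLinearMapAt ℝ x v)).2 := rfl

theorem bwd_apply (x : B) (y : F) : c.bwd x y =
    (trivializationAt F₀ V x₀).symmL ℝ x ((c.Φ x).inverse (0, y)) := rfl

theorem Φ_inverse {x : B} (hx : x ∈ c.U) (y : W × F) : c.Φ x ((c.Φ x).inverse y) = y := by
  obtain ⟨e, he⟩ := c.inv x hx
  rw [← he]; simp

theorem inverse_Φ {x : B} (hx : x ∈ c.U) (y : F₀) : (c.Φ x).inverse (c.Φ x y) = y := by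
  obtain ⟨e, he⟩ := c.inv x hx
  rw [← he]; simp

theorem bwd_mem {x : B} (hx : x ∈ c.U) (y : F) : c.bwd x y ∈ K x := by
  rw [c.spec x hx, bwd_apply, Trivialization.continuousLinearMapAt_symmL _ (c.sub hx),
    c.Φ_inverse hx]

theorem fwd_bwd {x : B} (hx : x ∈ c.U) (y : F) : c.fwd x (c.bwd x y) = y := by
  rw [fwd_apply, bwd_apply, Trivialization.continuousLinearMapAt_symmL _ (c.sub hx),
    c.Φ_inverse hx]

theorem Φ_of_mem {x : B} (hx : x ∈ c.U) {v : V x} (hv : v ∈ K x) :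
    c.Φ x ((trivializationAt F₀ V x₀).continuousLinearMapAt ℝ x v) = (0, c.fwd x v) := by
  ext1
  · exact (c.spec x hx v).1 hv
  · rfl

theorem bwd_fwd {x : B} (hx : x ∈ c.U) {v : V x} (hv : v ∈ K x) : c.bwd x (c.fwd x v) = v := by
  rw [bwd_apply, ← c.Φ_of_mem hx hv, c.inverse_Φ hx,
    Trivialization.symmL_continuousLinearMapAt _ (c.sub hx)]

open Classical in
/-- The inverse coordinate map, with values in the subbundle. -/
noncomputable def bwdK (x : B) (y : F) : K x :=
  if hx : x ∈ c.U then ⟨c.bwd x y, c.bwd_mem hx y⟩ else 0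

theorem coe_bwdK {x : B} (hx : x ∈ c.U) (y : F) : (c.bwdK x y : V x) = c.bwd x y := by
  simp [bwdK, hx]

/-- The local trivialization of the subbundle. -/
noncomputable def pretriv : Pretrivialization F (π F (fun x => K x)) where
  toFun p := (p.1, c.fwd p.1 p.2)
  invFun q := ⟨q.1, c.bwdK q.1 q.2⟩
  source := π F (fun x => K x) ⁻¹' c.U
  target := c.U ×ˢ univ
  map_source' p hp := ⟨hp, mem_univ _⟩
  map_target' q hq := hq.1
  left_inv' := by
    rintro ⟨x, v⟩ hp
    have hp : x ∈ c.U := hp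
    congr 1
    apply Subtype.ext
    rw [c.coe_bwdK hp]
    exact c.bwd_fwd hp v.2
  right_inv' := by
    rintro ⟨x, y⟩ hp
    have hp : x ∈ c.U := hp.1
    ext1
    · rfl
    · show c.fwd x (c.bwdK x y : V x) = y
      rw [c.coe_bwdK hp, c.fwd_bwd hp]
  open_target := c.isOpen.prod isOpen_univ
  baseSet := c.U
  open_baseSet := c.isOpen
  source_eq := rfl
  target_eq := rfl
  proj_toFun _ _ := rfl

theorem pretriv_apply (p : TotalSpace F (fun x => K x)) :
    c.pretriv p = (p.1, c.fwd p.1 p.2) := rfl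

theorem pretriv_symm {x : B} (hx : x ∈ c.U) (y : F) :
    (c.pretriv.symm x y : V x) = c.bwd x y := by
  have hx' : x ∈ c.pretriv.baseSet := hx
  rw [Pretrivialization.symm_apply _ hx', ← c.coe_bwdK hx]
  rfl

/-- Transition functions. -/
noncomputable def change {x₁ : B} (c : Chart (EB := EB) F₀ W F K x₀)
    (c' : Chart (EB := EB) F₀ W F K x₁) (x : B) : F →L[ℝ] F :=
  (ContinuousLinearMap.snd ℝ W F) ∘L (c'.Φ x) ∘L
    ((trivializationAt F₀ V x₀).coordChangeL ℝ (trivializationAt F₀ V x₁) x : F₀ →L[ℝ] F₀) ∘L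
    (c.Φ x).inverse ∘L (ContinuousLinearMap.inr ℝ W F)

theorem change_apply {x₁ : B} (c' : Chart (EB := EB) F₀ W F K x₁) {x : B} (hx : x ∈ c.U)
    (hx' : x ∈ c'.U) (y : F) : c.change c' x y = c'.fwd x (c.bwd x y) := by
  rw [fwd_apply, bwd_apply]
  simp only [change, ContinuousLinearMap.comp_apply, ContinuousLinearMap.coe_snd',
    ContinuousLinearMap.inr_apply, ContinuousLinearEquiv.coe_coe]
  rw [Trivialization.coordChangeL_apply _ _ ⟨c.sub hx, c'.sub hx'⟩,
    Trivialization.symmL_apply _ (c.sub hx),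
    Trivialization.continuousLinearMapAt_apply, Trivialization.linearMapAt_apply,
    if_pos (c'.sub hx')]

theorem smooth_inverse :
    ContMDiffOn 𝓘(ℝ, EB) 𝓘(ℝ, (W × F) →L[ℝ] F₀) ∞ (fun x => (c.Φ x).inverse) c.U := by
  intro x hx
  have := ((c.inv x hx).contDiffAt_map_inverse (n := ∞)).contMDiffAt
  exact this.comp_contMDiffWithinAt x (c.smooth x hx)

theorem smooth_change [ContMDiffVectorBundle ∞ F₀ V 𝓘(ℝ, EB)] {x₁ : B}
    (c' : Chart (EB := EB) F₀ W F K x₁) :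
    ContMDiffOn 𝓘(ℝ, EB) 𝓘(ℝ, F →L[ℝ] F) ∞ (c.change c') (c.U ∩ c'.U) := by
  have h1 := (c.smooth_inverse).mono (inter_subset_left (t := c'.U))
  have h2 := (c'.smooth).mono (inter_subset_right (s := c.U))
  have h3 := (contMDiffOn_coordChangeL (n := ∞) (IB := 𝓘(ℝ, EB)) (trivializationAt F₀ V x₀)
    (trivializationAt F₀ V x₁)).mono (inter_subset_inter c.sub c'.sub)
  exact contMDiffOn_const.clm_comp (h2.clm_comp (h3.clm_comp (h1.clm_comp contMDiffOn_const)))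

end Chart

variable (ch : ∀ x₀, Chart (EB := EB) F₀ W F K x₀)

theorem isInducing_aux [ContMDiffVectorBundle ∞ F₀ V 𝓘(ℝ, EB)] (b : B) :
    IsInducing ((ch b).pretriv ∘ TotalSpace.mk b) := by
  set c := ch b
  have hb : b ∈ c.U := c.mem
  have hcont : Continuous ((c.pretriv) ∘ TotalSpace.mk b) := by
    refine continuous_const.prodMk ?_
    show Continuous fun v : K b => c.fwd b v
    simp only [c.fwd_apply]
    fun_prop
  have hcont2 : Continuous (fun q : B × F => c.bwd b q.2) := by
    simp only [c.bwd_apply]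
    fun_prop
  have : IsInducing ((fun q : B × F => c.bwd b q.2) ∘ (c.pretriv ∘ TotalSpace.mk b)) := by
    have : ((fun q : B × F => c.bwd b q.2) ∘ (c.pretriv ∘ TotalSpace.mk b))
        = (Subtype.val : K b → V b) := by
      ext v
      exact c.bwd_fwd hb v.2
    rw [this]
    exact IsInducing.subtypeVal
  exact IsInducing.of_comp hcont hcont2 this

/-- The smooth vector bundle structure on the family of subspaces `K`. -/
noncomputable def prebundle [ContMDiffVectorBundle ∞ F₀ V 𝓘(ℝ, EB)] :
    VectorPrebundle ℝ F (fun x => K x) where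
  pretrivializationAtlas := range fun x₀ => (ch x₀).pretriv
  pretrivialization_linear' := by
    rintro _ ⟨x₀, rfl⟩
    exact ⟨fun x _ => ((ch x₀).fwd x ∘ₗ (K x).subtype).isLinear⟩
  pretrivializationAt x₀ := (ch x₀).pretriv
  mem_base_pretrivializationAt x₀ := (ch x₀).mem
  pretrivialization_mem_atlas x₀ := ⟨x₀, rfl⟩
  exists_coordChange := by
    rintro _ ⟨x₀, rfl⟩ _ ⟨x₁, rfl⟩
    refine ⟨(ch x₀).change (ch x₁), ((ch x₀).smooth_change (ch x₁)).continuousOn, ?_⟩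
    rintro x ⟨hx, hx'⟩ y
    rw [(ch x₀).change_apply (ch x₁) hx hx', Chart.pretriv_apply, ← (ch x₀).pretriv_symm hx]
  totalSpaceMk_isInducing b := isInducing_aux ch b

theorem prebundle_isContMDiff [ContMDiffVectorBundle ∞ F₀ V 𝓘(ℝ, EB)] :
    (prebundle ch).IsContMDiff 𝓘(ℝ, EB) ∞ where
  exists_contMDiffCoordChange := by
    rintro _ ⟨x₀, rfl⟩ _ ⟨x₁, rfl⟩
    refine ⟨(ch x₀).change (ch x₁), ((ch x₀).smooth_change (ch x₁)), ?_⟩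
    rintro x ⟨hx, hx'⟩ y
    rw [(ch x₀).change_apply (ch x₁) hx hx', Chart.pretriv_apply, ← (ch x₀).pretriv_symm hx]

section Smooth

variable [ContMDiffVectorBundle ∞ F₀ V 𝓘(ℝ, EB)]
  {EN : Type*} [NormedAddCommGroup EN] [NormedSpace ℝ EN] {HN : Type*} [TopologicalSpace HN]
  {IN : ModelWithCorners ℝ EN HN} {N : Type*} [TopologicalSpace N] [ChartedSpace HN N]

/-- A map into the subbundle is smooth iff it is smooth as a map into the ambient bundle. -/
theorem contMDiffAt_iff (g : N → TotalSpace F (fun x => K x)) (n : N) :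
    letI := (prebundle ch).totalSpaceTopology
    letI := (prebundle ch).toFiberBundle
    ContMDiffAt IN (𝓘(ℝ, EB).prod 𝓘(ℝ, F)) ∞ g n ↔
      ContMDiffAt IN (𝓘(ℝ, EB).prod 𝓘(ℝ, F₀)) ∞
        (fun n => (⟨(g n).1, ((g n).2 : V (g n).1)⟩ : TotalSpace F₀ V)) n := by
  letI := (prebundle ch).totalSpaceTopology
  letI := (prebundle ch).toFiberBundle
  rw [contMDiffAt_totalSpace, contMDiffAt_totalSpace]
  refine and_congr_right fun hb => ?_
  set x₀ := (g n).proj with hx₀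
  set c := ch x₀ with hc
  have hU : ∀ᶠ m in 𝓝 n, (g m).proj ∈ c.U :=
    hb.continuousAt.eventually (c.isOpen.mem_nhds c.mem)
  have hΦ : ContMDiffAt IN 𝓘(ℝ, F₀ →L[ℝ] (W × F)) ∞ (fun m => c.Φ (g m).proj) n :=
    ((c.smooth.contMDiffAt (c.isOpen.mem_nhds c.mem))).comp n hb
  have hΨ : ContMDiffAt IN 𝓘(ℝ, (W × F) →L[ℝ] F₀) ∞ (fun m => (c.Φ (g m).proj).inverse) n :=
    ((c.smooth_inverse.contMDiffAt (c.isOpen.mem_nhds c.mem))).comp n hb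
  have key : ∀ m, (trivializationAt F (fun x => K x) x₀ (g m)).2 = c.fwd (g m).1 (g m).2 :=
    fun m => rfl
  have key2 : ∀ᶠ m in 𝓝 n, (trivializationAt F₀ V x₀
      ⟨(g m).1, ((g m).2 : V (g m).1)⟩).2 = (trivializationAt F₀ V x₀).continuousLinearMapAt ℝ
        (g m).1 ((g m).2 : V (g m).1) := by
    filter_upwards [hU] with m hm
    rw [Trivialization.continuousLinearMapAt_apply, Trivialization.linearMapAt_apply,
      if_pos (c.sub hm)]
  constructor
  · intro h
    have h2 := hΨ.clm_apply ((contMDiffAt_const (c := (0 : W))).prodMk_space h)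
    refine h2.congr_of_eventuallyEq ?_
    filter_upwards [hU, key2] with m hm hk
    rw [hk, key, ← c.Φ_of_mem hm (g m).2.2, c.inverse_Φ hm]
  · intro h
    have h2 := contMDiffAt_const (c := ContinuousLinearMap.snd ℝ W F)
      |>.clm_apply (hΦ.clm_apply h)
    refine h2.congr_of_eventuallyEq ?_
    filter_upwards [key2] with m hk
    rw [key]
    show _ = ((c.Φ (g m).proj) (trivializationAt F₀ V x₀
      ⟨(g m).1, ((g m).2 : V (g m).1)⟩).2).2
    rw [hk, c.fwd_apply]

theorem contMDiff_iff (g : N → TotalSpace F (fun x => K x)) :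
    letI := (prebundle ch).totalSpaceTopology
    letI := (prebundle ch).toFiberBundle
    ContMDiff IN (𝓘(ℝ, EB).prod 𝓘(ℝ, F)) ∞ g ↔
      ContMDiff IN (𝓘(ℝ, EB).prod 𝓘(ℝ, F₀)) ∞
        (fun n => (⟨(g n).1, ((g n).2 : V (g n).1)⟩ : TotalSpace F₀ V)) :=
  forall_congr' fun n => contMDiffAt_iff ch g n

end Smooth

/-- The bundle exists as soon as the subspaces are, locally, kernels of smooth families of
surjections. -/
theorem Chart.exists_of_surjective [FiniteDimensional ℝ F₀] [FiniteDimensional ℝ W]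
    [FiniteDimensional ℝ F] (hF : Module.finrank ℝ F₀ = Module.finrank ℝ W + Module.finrank ℝ F)
    (x₀ : B) (U : Set B) (hU : IsOpen U) (hx₀ : x₀ ∈ U)
    (hsub : U ⊆ (trivializationAt F₀ V x₀).baseSet) (T : B → F₀ →L[ℝ] W)
    (hT : ContMDiffOn 𝓘(ℝ, EB) 𝓘(ℝ, F₀ →L[ℝ] W) ∞ T U) (hsurj : Function.Surjective (T x₀))
    (hK : ∀ x ∈ U, ∀ v : V x,
      v ∈ K x ↔ T x ((trivializationAt F₀ V x₀).continuousLinearMapAt ℝ x v) = 0) :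
    Nonempty (Chart (EB := EB) F₀ W F K x₀) := by
  obtain ⟨P, hP⟩ : ∃ P : F₀ →ₗ[ℝ] F, Function.Bijective ((T x₀ : F₀ →ₗ[ℝ] W).prod P) := by
    have hr : Module.finrank ℝ (LinearMap.ker (T x₀ : F₀ →ₗ[ℝ] W)) = Module.finrank ℝ F := by
      have := LinearMap.finrank_range_add_finrank_ker (T x₀ : F₀ →ₗ[ℝ] W)
      rw [LinearMap.range_eq_top.2 hsurj, finrank_top] at this
      omega
    let e : LinearMap.ker (T x₀ : F₀ →ₗ[ℝ] W) ≃ₗ[ℝ] F := LinearEquiv.ofFinrankEq _ _ hr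
    obtain ⟨q, hq⟩ := LinearMap.exists_leftInverse_of_injective
      (LinearMap.ker (T x₀ : F₀ →ₗ[ℝ] W)).subtype (Submodule.ker_subtype _)
    refine ⟨e.toLinearMap ∘ₗ q, ?_⟩
    have hinj : Function.Injective ((T x₀ : F₀ →ₗ[ℝ] W).prod (e.toLinearMap ∘ₗ q)) := by
      rw [injective_iff_map_eq_zero]
      intro v hv
      have h1 : T x₀ v = 0 := congrArg Prod.fst hv
      have h2 : e (q v) = 0 := congrArg Prod.snd hv
      have h3 : q v = 0 := by simpa using h2
      have h4 := LinearMap.congr_fun hq ⟨v, h1⟩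
      have h5 : q v = ⟨v, h1⟩ := h4
      rw [h3] at h5
      exact (congrArg Subtype.val h5).symm
    refine ⟨hinj, ?_⟩
    refine (LinearMap.injective_iff_surjective_of_finrank_eq_finrank ?_).1 hinj
    rw [Module.finrank_prod, hF]
  let Φ : B → F₀ →L[ℝ] (W × F) := fun x => (T x).prod (LinearMap.toContinuousLinearMap P)
  have hΦ : ContMDiffOn 𝓘(ℝ, EB) 𝓘(ℝ, F₀ →L[ℝ] (W × F)) ∞ Φ U := by
    have h1 := (contMDiffOn_const (I := 𝓘(ℝ, EB)) (s := U) (n := ∞)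
      (c := ContinuousLinearMap.inl ℝ W F)).clm_comp hT
    have h2 := h1.add (contMDiffOn_const (I := 𝓘(ℝ, EB)) (s := U) (n := ∞)
      (c := ContinuousLinearMap.inr ℝ W F ∘L (LinearMap.toContinuousLinearMap P)))
    refine h2.congr fun x _ => ?_
    ext v <;> simp [Φ]
  have hinv : (Φ x₀).IsInvertible := by
    refine ⟨(LinearEquiv.ofBijective _ hP).toContinuousLinearEquiv, ?_⟩
    ext v <;> rfl
  refine ⟨⟨U ∩ Φ ⁻¹' (range ((↑) : (F₀ ≃L[ℝ] (W × F)) → F₀ →L[ℝ] (W × F))), ?_, ?_, ?_, Φ, ?_, ?_,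
    ?_⟩⟩
  · exact hΦ.continuousOn.isOpen_inter_preimage hU ContinuousLinearEquiv.isOpen
  · exact ⟨hx₀, hinv⟩
  · exact fun x hx => hsub hx.1
  · exact hΦ.mono inter_subset_left
  · exact fun x hx => hx.2
  · exact fun x hx v => hK x hx.1 v

end KernelBundle

/-! ## Derivatives of functions along Lie brackets -/

section Calculus

variable {E : Type*} [NormedAddCommGroup E] [NormedSpace ℝ E]
  {M : Type*} [TopologicalSpace M] [ChartedSpace E M]
  {F : Type*} [NormedAddCommGroup F] [NormedSpace ℝ F]
  {E' : Type*} [NormedAddCommGroup E'] [NormedSpace ℝ E']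
  {N : Type*} [TopologicalSpace N] [ChartedSpace E' N]

theorem mvfderiv_comp_fun {g : M → F} {f : N → M} (x : N)
    (hg : MDifferentiableAt 𝓘(ℝ, E) 𝓘(ℝ, F) g (f x))
    (hf : MDifferentiableAt 𝓘(ℝ, E') 𝓘(ℝ, E) f x) (v : TangentSpace 𝓘(ℝ, E') x) :
    mvfderiv 𝓘(ℝ, E') (fun y => g (f y)) x v =
      mvfderiv 𝓘(ℝ, E) g (f x) (mfderiv 𝓘(ℝ, E') 𝓘(ℝ, E) f x v) :=
  mfderiv_comp_apply x hg hf v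

theorem mvfderiv_congr_nhds {g g' : M → F} {x : M} (h : g =ᶠ[𝓝 x] g') :
    mvfderiv 𝓘(ℝ, E) g x = mvfderiv 𝓘(ℝ, E) g' x := by
  ext v
  have := h.mfderiv_eq (I := 𝓘(ℝ, E)) (I' := 𝓘(ℝ, F))
  show (mfderiv 𝓘(ℝ, E) 𝓘(ℝ, F) g x v : F) = (mfderiv 𝓘(ℝ, E) 𝓘(ℝ, F) g' x v : F)
  exact congrArg (fun L : E →L[ℝ] F => L v) this

theorem mvfderiv_vectorSpace (g : E → F) (x : E) (v : E) :
    mvfderiv 𝓘(ℝ, E) g x v = fderiv ℝ g x v := by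
  exact congrArg (fun L : E →L[ℝ] F => L v) (mfderiv_eq_fderiv (f := g) (x := x))

variable [IsManifold 𝓘(ℝ, E) ∞ M] [CompleteSpace E]

theorem mvfderiv_mlieBracket {v w : ∀ x : M, TangentSpace 𝓘(ℝ, E) x} {h : M → F} {x₀ : M}
    (hv : MDifferentiableAt 𝓘(ℝ, E) (𝓘(ℝ, E).prod 𝓘(ℝ, E))
      (fun x => (⟨x, v x⟩ : TangentBundle 𝓘(ℝ, E) M)) x₀)
    (hw : MDifferentiableAt 𝓘(ℝ, E) (𝓘(ℝ, E).prod 𝓘(ℝ, E))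
      (fun x => (⟨x, w x⟩ : TangentBundle 𝓘(ℝ, E) M)) x₀)
    (hh : ContMDiffAt 𝓘(ℝ, E) 𝓘(ℝ, F) ∞ h x₀) :
    mvfderiv 𝓘(ℝ, E) h x₀ (mlieBracket 𝓘(ℝ, E) v w x₀) =
      mvfderiv 𝓘(ℝ, E) (fun y => mvfderiv 𝓘(ℝ, E) h y (w y)) x₀ (v x₀) -
        mvfderiv 𝓘(ℝ, E) (fun y => mvfderiv 𝓘(ℝ, E) h y (v y)) x₀ (w x₀) := by
  have : IsManifold 𝓘(ℝ, E) 2 M := inferInstance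
  have : IsManifold 𝓘(ℝ, E) 1 M := inferInstance
  set φ := extChartAt 𝓘(ℝ, E) x₀ with hφ
  set y₀ : E := φ x₀ with hy₀
  have hx₀ : φ.symm y₀ = x₀ := extChartAt_to_inv x₀
  have ht : φ.target ∈ 𝓝 y₀ := extChartAt_target_mem_nhds x₀
  have hs : φ.source ∈ 𝓝 x₀ := extChartAt_source_mem_nhds x₀
  -- coordinate expressions
  let v' : E → E := mpullbackWithin 𝓘(ℝ, E) 𝓘(ℝ, E) φ.symm v (range 𝓘(ℝ, E))
  let w' : E → E := mpullbackWithin 𝓘(ℝ, E) 𝓘(ℝ, E) φ.symm w (range 𝓘(ℝ, E))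
  let h' : E → F := fun y => h (φ.symm y)
  have hv' : DifferentiableAt ℝ v' y₀ := by
    have := (mdifferentiableWithinAt_univ.2 hv).differentiableWithinAt_mpullbackWithin_vectorField
    rw [show (extChartAt 𝓘(ℝ, E) x₀).symm ⁻¹' univ ∩ range 𝓘(ℝ, E) = (univ : Set E) by simp] at this
    exact differentiableWithinAt_univ.1 this
  have hw' : DifferentiableAt ℝ w' y₀ := by
    have := (mdifferentiableWithinAt_univ.2 hw).differentiableWithinAt_mpullbackWithin_vectorField
    rw [show (extChartAt 𝓘(ℝ, E) x₀).symm ⁻¹' univ ∩ range 𝓘(ℝ, E) = (univ : Set E) by simp] at this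
    exact differentiableWithinAt_univ.1 this
  have hsymm : ContMDiffAt 𝓘(ℝ, E) 𝓘(ℝ, E) ∞ φ.symm y₀ := by
    have := contMDiffWithinAt_extChartAt_symm_range (I := 𝓘(ℝ, E)) (n := ∞) x₀
      (mem_extChartAt_target (I := 𝓘(ℝ, E)) x₀)
    simpa using! this
  have hh' : ContDiffAt ℝ ∞ h' y₀ := by
    have : ContMDiffAt 𝓘(ℝ, E) 𝓘(ℝ, F) ∞ h' y₀ :=
      ContMDiffAt.comp y₀ (by rw [hx₀]; exact hh) hsymm
    exact this.contDiffAt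
  have hhd : ∀ᶠ x in 𝓝 x₀, MDifferentiableAt 𝓘(ℝ, E) 𝓘(ℝ, F) h x := by
    have h1 : ContMDiffAt 𝓘(ℝ, E) 𝓘(ℝ, F) 1 h x₀ := hh.of_le (by exact_mod_cast le_top)
    filter_upwards [(contMDiffAt_iff_contMDiffAt_nhds (by simp)).1 h1] with x hx
    exact hx.mdifferentiableAt (by simp)
  -- the function `dh(u)` in coordinates
  have key : ∀ (u : ∀ x : M, TangentSpace 𝓘(ℝ, E) x), 
      (fun x => mvfderiv 𝓘(ℝ, E) h x (u x)) =ᶠ[𝓝 x₀] 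
      fun x => (fun y => fderiv ℝ h' y
        (mpullbackWithin 𝓘(ℝ, E) 𝓘(ℝ, E) φ.symm u (range 𝓘(ℝ, E)) y : E)) (φ x) := by
    intro u
    filter_upwards [hhd, hs] with x hx hxs
    have hφx : φ x ∈ φ.target := φ.map_source hxs
    have hinv := isInvertible_mfderivWithin_extChartAt_symm (I := 𝓘(ℝ, E)) (x := x₀) hφx
    have hl : φ.symm (φ x) = x := φ.left_inv hxs
    have hd : MDifferentiableAt 𝓘(ℝ, E) 𝓘(ℝ, E) φ.symm (φ x) := by
      have := (contMDiffWithinAt_extChartAt_symm_range (I := 𝓘(ℝ, E)) (n := 1) x₀ hφx)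
      have := this.mdifferentiableWithinAt (by simp)
      simpa using! this
    have hx' : MDifferentiableAt 𝓘(ℝ, E) 𝓘(ℝ, F) h (φ.symm (φ x)) := by rwa [hl]
    have e1 := mvfderiv_comp_fun (φ x) hx' hd
      (mpullbackWithin 𝓘(ℝ, E) 𝓘(ℝ, E) φ.symm u (range 𝓘(ℝ, E)) (φ x))
    have e2 : mfderiv 𝓘(ℝ, E) 𝓘(ℝ, E) φ.symm (φ x)
        (mpullbackWithin 𝓘(ℝ, E) 𝓘(ℝ, E) φ.symm u (range 𝓘(ℝ, E)) (φ x)) = u (φ.symm (φ x)) := by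
      have hr : mfderivWithin 𝓘(ℝ, E) 𝓘(ℝ, E) φ.symm (range 𝓘(ℝ, E)) (φ x) =
        mfderiv 𝓘(ℝ, E) 𝓘(ℝ, E) φ.symm (φ x) := by
        simp [mfderivWithin_univ]
      rw [mpullbackWithin_apply, ← hr]
      exact hinv.self_apply_inverse _
    rw [e2] at e1
    refine Eq.trans ?_ (e1.symm.trans (mvfderiv_vectorSpace h' (φ x) _))
    rw [hl]
  have key2 : ∀ (k : M → F) (k' : E → F) (u : TangentSpace 𝓘(ℝ, E) x₀),
      k =ᶠ[𝓝 x₀] (fun x => k' (φ x)) → DifferentiableAt ℝ k' y₀ →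
      mvfderiv 𝓘(ℝ, E) k x₀ u = fderiv ℝ k' y₀ (u : E) := by
    intro k k' u hk hk'
    rw [mvfderiv_congr_nhds hk]
    have h3 := mvfderiv_comp_fun (g := k') (f := φ) x₀ hk'.mdifferentiableAt
      (mdifferentiableAt_extChartAt (mem_chart_source E x₀)) u
    refine h3.trans ((mvfderiv_vectorSpace k' (φ x₀) _).trans ?_)
    have h4 : (mfderiv 𝓘(ℝ, E) 𝓘(ℝ, E) φ x₀ u : E) = (u : E) :=
      congrArg (fun L : E →L[ℝ] E => L u) (mfderiv_extChartAt_self (I := 𝓘(ℝ, E)) (x := x₀))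
    exact congrArg (fderiv ℝ k' y₀) h4
  have hsym := (hh'.isSymmSndFDerivAt (n := ∞) (by simpa using ENat.LEInfty.out))
  have hfd : DifferentiableAt ℝ (fderiv ℝ h') y₀ := by
    have := hh'.fderiv_right (m := 1) (by rw [one_add_one_eq_two]; exact ENat.LEInfty.out)
    exact this.differentiableAt (by simp)
  have hv0 : (v x₀ : E) = v' y₀ := by
    have h1 : (v (φ.symm y₀) : E) = v x₀ := congrArg (fun x => (v x : E)) hx₀
    have h2 : (mfderivWithin 𝓘(ℝ, E) 𝓘(ℝ, E) φ.symm (range 𝓘(ℝ, E)) y₀ : E →L[ℝ] E).inverse =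
        ContinuousLinearMap.id ℝ E := by
      rw [show (mfderivWithin 𝓘(ℝ, E) 𝓘(ℝ, E) φ.symm (range 𝓘(ℝ, E)) y₀ : E →L[ℝ] E) =
        ContinuousLinearMap.id ℝ E from mfderivWithin_range_extChartAt_symm]
      exact ContinuousLinearMap.inverse_id
    exact (((congrArg (fun L : E →L[ℝ] E => L (v (φ.symm y₀) : E)) h2)).trans h1).symm
  have hw0 : (w x₀ : E) = w' y₀ := by
    have h1 : (w (φ.symm y₀) : E) = w x₀ := congrArg (fun x => (w x : E)) hx₀
    have h2 : (mfderivWithin 𝓘(ℝ, E) 𝓘(ℝ, E) φ.symm (range 𝓘(ℝ, E)) y₀ : E →L[ℝ] E).inverse =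
        ContinuousLinearMap.id ℝ E := by
      rw [show (mfderivWithin 𝓘(ℝ, E) 𝓘(ℝ, E) φ.symm (range 𝓘(ℝ, E)) y₀ : E →L[ℝ] E) =
        ContinuousLinearMap.id ℝ E from mfderivWithin_range_extChartAt_symm]
      exact ContinuousLinearMap.inverse_id
    exact (((congrArg (fun L : E →L[ℝ] E => L (w (φ.symm y₀) : E)) h2)).trans h1).symm
  have hbr : (mlieBracket 𝓘(ℝ, E) v w x₀ : E) = lieBracket ℝ v' w' y₀ := by
    have h0 : mlieBracket 𝓘(ℝ, E) v w x₀ = (mfderiv 𝓘(ℝ, E) 𝓘(ℝ, E) φ x₀).inverse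
      ((lieBracketWithin ℝ v' w' ((extChartAt 𝓘(ℝ, E) x₀).symm ⁻¹' univ ∩ range 𝓘(ℝ, E))) y₀) := by
      rw [← mlieBracketWithin_univ]
      exact mlieBracketWithin_apply
    rw [show (extChartAt 𝓘(ℝ, E) x₀).symm ⁻¹' univ ∩ range 𝓘(ℝ, E) = (univ : Set E) by simp,
      lieBracketWithin_univ] at h0
    rw [h0]
    have h1 : (mfderiv 𝓘(ℝ, E) 𝓘(ℝ, E) φ x₀ : E →L[ℝ] E) = ContinuousLinearMap.id ℝ E :=
      mfderiv_extChartAt_self (I := 𝓘(ℝ, E)) (x := x₀)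
    have h2 : (mfderiv 𝓘(ℝ, E) 𝓘(ℝ, E) φ x₀ : E →L[ℝ] E).inverse = ContinuousLinearMap.id ℝ E := by
      rw [h1]; exact ContinuousLinearMap.inverse_id
    exact congrArg (fun L : E →L[ℝ] E => L (lieBracket ℝ v' w' y₀)) h2
  rw [key2 h h' _ ?_ (hh'.differentiableAt (by simp)), key2 _ (fun y => fderiv ℝ h' y (w' y)) _ (key w) ?_,
    key2 _ (fun y => fderiv ℝ h' y (v' y)) _ (key v) ?_]
  · have e1 := (hfd.hasFDerivAt.clm_apply hw'.hasFDerivAt).fderiv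
    have e2 := (hfd.hasFDerivAt.clm_apply hv'.hasFDerivAt).fderiv
    rw [e1, e2, hv0, hw0, hbr, lieBracket]
    have h4 := hsym (v' y₀) (w' y₀)
    simp only [add_apply, ContinuousLinearMap.comp_apply, map_sub,
      ContinuousLinearMap.flip_apply]
    rw [h4]
    abel
  · exact hfd.clm_apply hv'
  · exact hfd.clm_apply hw'
  · filter_upwards [hs] with x hx
    show h x = h (φ.symm (φ x))
    rw [φ.left_inv hx]

end Calculus

section Action

set_option linter.unusedSectionVars false

variable (EG : Type*) [NormedAddCommGroup EG] [NormedSpace ℝ EG]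
  (G : Type*) [TopologicalSpace G] [ChartedSpace EG G] [Group G]
  (EM : Type*) [NormedAddCommGroup EM] [NormedSpace ℝ EM]
  {M : Type*} [TopologicalSpace M] [ChartedSpace EM M] [MulAction G M]

/-- The infinitesimal action at `m`: it sends `ξ ∈ 𝔤 = T₁G` to the value `ξ†(m) ∈ T_m M` of the
infinitesimal generator of `ξ`, i.e. it is the derivative at `1` of the orbit map `g ↦ g • m`.
(In Mathlib the tangent space `T₁G` is by definition the model space `EG`.) -/
noncomputable def infGen (m : M) : EG →L[ℝ] TangentSpace 𝓘(ℝ, EM) m :=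
  mfderiv 𝓘(ℝ, EG) 𝓘(ℝ, EM) (fun g : G => g • m) 1

variable {EG EM}

variable {N : Type*} {EN : Type*} [NormedAddCommGroup EN] [NormedSpace ℝ EN]
  [TopologicalSpace N] [ChartedSpace EN N]

variable [IsManifold 𝓘(ℝ, EM) ∞ M]

theorem contMDiffAt_tangent_iff {f : N → M} {v : ∀ n, TangentSpace 𝓘(ℝ, EM) (f n)} {n₀ : N}
    (hf : ContMDiffAt 𝓘(ℝ, EN) 𝓘(ℝ, EM) ∞ f n₀) :
    ContMDiffAt 𝓘(ℝ, EN) (𝓘(ℝ, EM).prod 𝓘(ℝ, EM)) ∞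
      (fun n => (⟨f n, v n⟩ : TangentBundle 𝓘(ℝ, EM) M)) n₀ ↔
    ContMDiffAt 𝓘(ℝ, EN) 𝓘(ℝ, EM) ∞
      (fun n => mvfderiv 𝓘(ℝ, EM) (extChartAt 𝓘(ℝ, EM) (f n₀)) (f n) (v n)) n₀ := by
  rw [contMDiffAt_totalSpace, and_iff_right hf]
  refine Filter.EventuallyEq.contMDiffAt_iff ?_
  filter_upwards [hf.continuousAt.preimage_mem_nhds
    (chart_source_mem_nhds EM (f n₀))] with n hn
  have h1 := TangentBundle.continuousLinearMapAt_trivializationAt (I := 𝓘(ℝ, EM)) hn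
  have h2 := congrArg (fun L : TangentSpace 𝓘(ℝ, EM) (f n) →L[ℝ] EM => L (v n)) h1
  refine Eq.trans ?_ h2
  show _ = (trivializationAt EM (TangentSpace 𝓘(ℝ, EM)) (f n₀)).continuousLinearMapAt ℝ (f n) (v n)
  rw [Trivialization.continuousLinearMapAt_apply, Trivialization.linearMapAt_apply, if_pos]
  exact hn

variable [LieGroup 𝓘(ℝ, EG) ∞ G] [ContMDiffSMul 𝓘(ℝ, EG) 𝓘(ℝ, EM) ∞ G M]

variable (EG EM) in
/-- The infinitesimal action, read in the chart of `M` at `m₀`. -/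
noncomputable def genCoord (m₀ m : M) : EG →L[ℝ] EM :=
  mvfderiv 𝓘(ℝ, EM) (extChartAt 𝓘(ℝ, EM) m₀) m ∘L infGen EG G EM m

theorem contMDiffAt_genCoord (m₀ : M) :
    ContMDiffAt 𝓘(ℝ, EM) 𝓘(ℝ, EG →L[ℝ] EM) ∞ (genCoord EG G EM m₀) m₀ := by
  have : IsManifold 𝓘(ℝ, EM) 1 M := inferInstance
  have hsm : ContMDiff (𝓘(ℝ, EM).prod 𝓘(ℝ, EG)) 𝓘(ℝ, EM) ∞
      (Function.uncurry fun (m : M) (g : G) => g • m) :=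
    (contMDiff_smul (I := 𝓘(ℝ, EG)) (I' := 𝓘(ℝ, EM)) (n := ∞) (G := G) (M := M)).comp
      (contMDiff_snd.prodMk contMDiff_fst)
  have h := ContMDiffAt.mfderiv (m := ∞) (n := ∞) (x₀ := m₀) (fun (m : M) (g : G) => g • m)
    (fun _ => 1) hsm.contMDiffAt contMDiffAt_const (by simp)
  simp only [one_smul] at h
  refine h.congr_of_eventuallyEq ?_
  filter_upwards [chart_source_mem_nhds EM m₀] with m hm
  have e := inTangentCoordinates_eq_mfderiv_comp (I := 𝓘(ℝ, EG)) (I' := 𝓘(ℝ, EM))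
    (f := fun _ : M => (1 : G)) (g := fun m : M => m)
    (ϕ := fun m => infGen EG G EM m) (x₀ := m₀) (x := m) (mem_chart_source EG 1) hm
  refine Eq.trans ?_ e.symm
  have h1 : (mfderivWithin 𝓘(ℝ, EG) 𝓘(ℝ, EG) (extChartAt 𝓘(ℝ, EG) (1 : G)).symm
      (range 𝓘(ℝ, EG)) (extChartAt 𝓘(ℝ, EG) (1 : G) 1) : EG →L[ℝ] EG) =
        ContinuousLinearMap.id ℝ EG :=
    mfderivWithin_range_extChartAt_symm
  ext ξ
  exact (congrArg (fun L : EG →L[ℝ] EG => (mvfderiv 𝓘(ℝ, EM) (extChartAt 𝓘(ℝ, EM) m₀) m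
    (infGen EG G EM m (L ξ)) : EM)) h1).symm

/-- Infinitesimal generators depend smoothly on all data. -/
theorem contMDiffAt_infGen {f : N → M} {X : N → EG} {n₀ : N}
    (hf : ContMDiffAt 𝓘(ℝ, EN) 𝓘(ℝ, EM) ∞ f n₀)
    (hX : ContMDiffAt 𝓘(ℝ, EN) 𝓘(ℝ, EG) ∞ X n₀) :
    ContMDiffAt 𝓘(ℝ, EN) (𝓘(ℝ, EM).prod 𝓘(ℝ, EM)) ∞
      (fun n => (⟨f n, infGen EG G EM (f n) (X n)⟩ : TangentBundle 𝓘(ℝ, EM) M)) n₀ := by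
  rw [contMDiffAt_tangent_iff hf]
  exact ((contMDiffAt_genCoord (EG := EG) (EM := EM) G (f n₀)).comp n₀ hf).clm_apply hX

/-- The infinitesimal generator `ξ†` of `ξ`, a vector field on `M`. -/
noncomputable abbrev fundField (G : Type*) [TopologicalSpace G] [ChartedSpace EG G] [Group G] (EM : Type*)
    [NormedAddCommGroup EM] [NormedSpace ℝ EM] [ChartedSpace EM M] [MulAction G M]
    (ξ : EG) (m : M) : TangentSpace 𝓘(ℝ, EM) m := infGen EG G EM m ξ

theorem contMDiff_fundField (ξ : EG) :
    ContMDiff 𝓘(ℝ, EM) (𝓘(ℝ, EM).prod 𝓘(ℝ, EM)) ∞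
      (fun m : M => (⟨m, fundField G EM ξ m⟩ : TangentBundle 𝓘(ℝ, EM) M)) :=
  fun _ => contMDiffAt_infGen G contMDiffAt_id contMDiffAt_const

theorem mdifferentiableAt_fundField (ξ : EG) (m : M) :
    MDifferentiableAt 𝓘(ℝ, EM) (𝓘(ℝ, EM).prod 𝓘(ℝ, EM))
      (fun m : M => (⟨m, fundField G EM ξ m⟩ : TangentBundle 𝓘(ℝ, EM) M)) m :=
  ((contMDiff_fundField (EM := EM) G ξ) m).mdifferentiableAt (by simp)

/-- Derivative of the orbit map `g ↦ g • m` at an arbitrary point. -/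
theorem mfderiv_orbit (m : M) (g : G) (ξ : EG) :
    mfderiv 𝓘(ℝ, EG) 𝓘(ℝ, EM) (fun g : G => g • m) g (fundField G EG ξ g) =
      fundField G EM ξ (g • m) := by
  have h1 : MDifferentiableAt 𝓘(ℝ, EG) 𝓘(ℝ, EM) (fun g : G => g • m) ((1 : G) • g) :=
    ((contMDiff_smul (I := 𝓘(ℝ, EG)) (I' := 𝓘(ℝ, EM)) (n := ∞) (G := G) (M := M)).comp
      (contMDiff_id.prodMk contMDiff_const)).mdifferentiableAt (by simp)
  have h2 : MDifferentiableAt 𝓘(ℝ, EG) 𝓘(ℝ, EG) (fun h : G => h • g) 1 :=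
    ((contMDiff_smul (I := 𝓘(ℝ, EG)) (I' := 𝓘(ℝ, EG)) (n := ∞) (G := G) (M := G)).comp
      (contMDiff_id.prodMk contMDiff_const)).mdifferentiableAt (by simp)
  have h3 := mfderiv_comp_apply (I := 𝓘(ℝ, EG)) (I' := 𝓘(ℝ, EG)) (I'' := 𝓘(ℝ, EM)) (1 : G) h1 h2 ξ
  have h4 : ((fun g : G => g • m) ∘ fun h : G => h • g) = fun h : G => h • (g • m) := by
    ext h; simp [mul_smul]
  rw [h4, one_smul] at h3
  exact h3.symm

end Action

section Action2

set_option linter.unusedSectionVars false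

theorem mvfderiv_clm_apply_fun {EN : Type*} [NormedAddCommGroup EN] [NormedSpace ℝ EN]
    {N : Type*} [TopologicalSpace N] [ChartedSpace EN N]
    {F₁ F₂ : Type*} [NormedAddCommGroup F₁] [NormedSpace ℝ F₁] [NormedAddCommGroup F₂]
    [NormedSpace ℝ F₂] {A : N → F₁ →L[ℝ] F₂} {Y : N → F₁} {n : N}
    (hA : MDifferentiableAt 𝓘(ℝ, EN) 𝓘(ℝ, F₁ →L[ℝ] F₂) A n)
    (hY : MDifferentiableAt 𝓘(ℝ, EN) 𝓘(ℝ, F₁) Y n) (v : TangentSpace 𝓘(ℝ, EN) n) :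
    mvfderiv 𝓘(ℝ, EN) (fun k => A k (Y k)) n v =
      mvfderiv 𝓘(ℝ, EN) (fun k => A k (Y n)) n v + A n (mvfderiv 𝓘(ℝ, EN) Y n v) := by
  have e1 := mvfderiv_comp_fun (g := fun q : (F₁ →L[ℝ] F₂) × F₁ => q.1 q.2)
    (f := fun k => (A k, Y k)) n
    (differentiableAt_fst.clm_apply differentiableAt_snd).mdifferentiableAt
    (hA.prodMk_space hY) v
  have e2 := mvfderiv_comp_fun (g := fun q : F₁ →L[ℝ] F₂ => q (Y n)) (f := A) n
    (differentiableAt_id.clm_apply (differentiableAt_const _)).mdifferentiableAt hA v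
  have e3 : (mfderiv 𝓘(ℝ, EN) 𝓘(ℝ, (F₁ →L[ℝ] F₂) × F₁) (fun k => (A k, Y k)) n v :
      (F₁ →L[ℝ] F₂) × F₁) = (mvfderiv 𝓘(ℝ, EN) A n v, mvfderiv 𝓘(ℝ, EN) Y n v) := by
    have p1 := mvfderiv_comp_fun (g := (Prod.fst : (F₁ →L[ℝ] F₂) × F₁ → _))
      (f := fun k => (A k, Y k)) n differentiableAt_fst.mdifferentiableAt (hA.prodMk_space hY) v
    have p2 := mvfderiv_comp_fun (g := (Prod.snd : (F₁ →L[ℝ] F₂) × F₁ → _))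
      (f := fun k => (A k, Y k)) n differentiableAt_snd.mdifferentiableAt (hA.prodMk_space hY) v
    have q1 := p1.trans (mvfderiv_vectorSpace _ _ _)
    have q2 := p2.trans (mvfderiv_vectorSpace _ _ _)
    rw [fderiv_fst] at q1
    rw [fderiv_snd] at q2
    exact Prod.ext q1.symm q2.symm
  refine e1.trans ?_
  refine Eq.trans ?_ (congrArg (· + A n (mvfderiv 𝓘(ℝ, EN) Y n v)) e2.symm)
  have d1 := (hasFDerivAt_fst (𝕜 := ℝ) (p := (A n, Y n))).clm_apply
    (hasFDerivAt_snd (𝕜 := ℝ) (p := (A n, Y n)))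
  have d2 := (hasFDerivAt_id (𝕜 := ℝ) (A n)).clm_apply (hasFDerivAt_const (Y n) (A n))
  have d1' := congrArg (fun L => L (mvfderiv 𝓘(ℝ, EN) A n v, mvfderiv 𝓘(ℝ, EN) Y n v)) d1.fderiv
  have d2' := congrArg (fun L => L (mvfderiv 𝓘(ℝ, EN) A n v)) d2.fderiv
  refine (mvfderiv_vectorSpace _ _ _).trans ?_
  refine (congrArg (fderiv ℝ (fun q : (F₁ →L[ℝ] F₂) × F₁ => q.1 q.2) (A n, Y n)) e3).trans ?_
  refine d1'.trans (Eq.trans ?_ (congrArg (· + A n (mvfderiv 𝓘(ℝ, EN) Y n v))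
    ((mvfderiv_vectorSpace _ _ _).trans d2').symm))
  simp [add_comm]

theorem mvfderiv_extChartAt_self {EM : Type*} [NormedAddCommGroup EM] [NormedSpace ℝ EM]
    {M : Type*} [TopologicalSpace M] [ChartedSpace EM M] [IsManifold 𝓘(ℝ, EM) ∞ M] (m : M)
    (u : TangentSpace 𝓘(ℝ, EM) m) : mvfderiv 𝓘(ℝ, EM) (extChartAt 𝓘(ℝ, EM) m) m u = u :=
  have : IsManifold 𝓘(ℝ, EM) 1 M := inferInstance
  congrArg (fun L : EM →L[ℝ] EM => L u) (mfderiv_extChartAt_self (I := 𝓘(ℝ, EM)) (x := m))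

variable {EG : Type*} [NormedAddCommGroup EG] [NormedSpace ℝ EG]
  (G : Type*) [TopologicalSpace G] [ChartedSpace EG G] [Group G]
  {EM : Type*} [NormedAddCommGroup EM] [NormedSpace ℝ EM]
  {M : Type*} [TopologicalSpace M] [ChartedSpace EM M] [MulAction G M]

theorem infGen_one_right [IsManifold 𝓘(ℝ, EG) 1 G] (ξ : EG) :
    (infGen EG G EG (1 : G) ξ : EG) = ξ := by
  have h : (fun g : G => g • (1 : G)) = id := by ext g; simp
  have : (infGen EG G EG (1 : G) : EG →L[ℝ] EG) = ContinuousLinearMap.id ℝ EG := by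
    show (mfderiv 𝓘(ℝ, EG) 𝓘(ℝ, EG) (fun g : G => g • (1 : G)) 1 : EG →L[ℝ] EG) = _
    rw [h]
    exact mfderiv_id
  exact congrArg (fun L : EG →L[ℝ] EG => L ξ) this

variable {N : Type*} {EN : Type*} [NormedAddCommGroup EN] [NormedSpace ℝ EN]
  [TopologicalSpace N] [ChartedSpace EN N]

/-- The bracket on `𝔤 = T₁G` defined by right-invariant vector fields: the right-invariant vector
field on `G` with value `ξ` at `1` is the infinitesimal generator of `ξ` for the action of `G` on
itself by left translation. -/
noncomputable def bracketR (ξ η : EG) : EG :=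
  mlieBracket 𝓘(ℝ, EG) (fundField G EG ξ) (fundField G EG η) (1 : G)

variable [IsManifold 𝓘(ℝ, EM) ∞ M] [LieGroup 𝓘(ℝ, EG) ∞ G]
  [ContMDiffSMul 𝓘(ℝ, EG) 𝓘(ℝ, EM) ∞ G M] [IsManifold 𝓘(ℝ, EN) ∞ N]
  [CompleteSpace EN] [CompleteSpace EM] [CompleteSpace EG]

theorem mfderiv_mlieBracket_aux {f : N → M} {v w : ∀ n : N, TangentSpace 𝓘(ℝ, EN) n}
    {X Y : N → EG} {n₀ : N}
    (hf : ContMDiffAt 𝓘(ℝ, EN) 𝓘(ℝ, EM) ∞ f n₀)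
    (hv : MDifferentiableAt 𝓘(ℝ, EN) (𝓘(ℝ, EN).prod 𝓘(ℝ, EN))
      (fun x => (⟨x, v x⟩ : TangentBundle 𝓘(ℝ, EN) N)) n₀)
    (hw : MDifferentiableAt 𝓘(ℝ, EN) (𝓘(ℝ, EN).prod 𝓘(ℝ, EN))
      (fun x => (⟨x, w x⟩ : TangentBundle 𝓘(ℝ, EN) N)) n₀)
    (hX : MDifferentiableAt 𝓘(ℝ, EN) 𝓘(ℝ, EG) X n₀)
    (hY : MDifferentiableAt 𝓘(ℝ, EN) 𝓘(ℝ, EG) Y n₀)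
    (hvX : ∀ n, mfderiv 𝓘(ℝ, EN) 𝓘(ℝ, EM) f n (v n) = infGen EG G EM (f n) (X n))
    (hwY : ∀ n, mfderiv 𝓘(ℝ, EN) 𝓘(ℝ, EM) f n (w n) = infGen EG G EM (f n) (Y n)) :
    mfderiv 𝓘(ℝ, EN) 𝓘(ℝ, EM) f n₀ (mlieBracket 𝓘(ℝ, EN) v w n₀) =
      infGen EG G EM (f n₀) (mvfderiv 𝓘(ℝ, EN) Y n₀ (v n₀) - mvfderiv 𝓘(ℝ, EN) X n₀ (w n₀)) +
      mlieBracket 𝓘(ℝ, EM) (fundField G EM (X n₀)) (fundField G EM (Y n₀)) (f n₀) := by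
  have : IsManifold 𝓘(ℝ, EM) 1 M := inferInstance
  set m₀ := f n₀ with hm₀
  set ψ := extChartAt 𝓘(ℝ, EM) m₀ with hψ
  have hψs : ContMDiffAt 𝓘(ℝ, EM) 𝓘(ℝ, EM) ∞ ψ m₀ := contMDiffAt_extChartAt
  have hψf : ContMDiffAt 𝓘(ℝ, EN) 𝓘(ℝ, EM) ∞ (fun n => ψ (f n)) n₀ := hψs.comp n₀ hf
  have hfd : ∀ᶠ n in 𝓝 n₀, MDifferentiableAt 𝓘(ℝ, EN) 𝓘(ℝ, EM) f n := by
    have : IsManifold 𝓘(ℝ, EN) 1 N := inferInstance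
    have h1 : ContMDiffAt 𝓘(ℝ, EN) 𝓘(ℝ, EM) 1 f n₀ := hf.of_le (by exact_mod_cast le_top)
    filter_upwards [(contMDiffAt_iff_contMDiffAt_nhds (by simp)).1 h1] with x hx
    exact hx.mdifferentiableAt (by simp)
  have hsrc : ∀ᶠ n in 𝓝 n₀, f n ∈ (chartAt EM m₀).source :=
    hf.continuousAt.preimage_mem_nhds (chart_source_mem_nhds EM m₀)
  have hb : MDifferentiableAt 𝓘(ℝ, EM) 𝓘(ℝ, EG →L[ℝ] EM) (genCoord EG G EM m₀) m₀ :=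
    (contMDiffAt_genCoord (EG := EG) (EM := EM) G m₀).mdifferentiableAt (by simp)
  have hfd0 : MDifferentiableAt 𝓘(ℝ, EN) 𝓘(ℝ, EM) f n₀ := hf.mdifferentiableAt (by simp)
  have hchain : ∀ᶠ n in 𝓝 n₀, ∀ u : TangentSpace 𝓘(ℝ, EN) n,
      mvfderiv 𝓘(ℝ, EN) (fun n => ψ (f n)) n u =
      mvfderiv 𝓘(ℝ, EM) ψ (f n) (mfderiv 𝓘(ℝ, EN) 𝓘(ℝ, EM) f n u) := by
    filter_upwards [hfd, hsrc] with n h1 h2 u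
    exact mvfderiv_comp_fun n (mdifferentiableAt_extChartAt h2) h1 u
  have key : ∀ (u : ∀ n : N, TangentSpace 𝓘(ℝ, EN) n) (Z : N → EG),
      MDifferentiableAt 𝓘(ℝ, EN) 𝓘(ℝ, EG) Z n₀ →
      (∀ n, mfderiv 𝓘(ℝ, EN) 𝓘(ℝ, EM) f n (u n) = infGen EG G EM (f n) (Z n)) →
      ∀ (u' : TangentSpace 𝓘(ℝ, EN) n₀) (ζ : EG),
      mfderiv 𝓘(ℝ, EN) 𝓘(ℝ, EM) f n₀ u' = infGen EG G EM (f n₀) ζ →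
      mvfderiv 𝓘(ℝ, EN) (fun n => mvfderiv 𝓘(ℝ, EN) (fun n => ψ (f n)) n (u n)) n₀ u' =
        mvfderiv 𝓘(ℝ, EM) (fun m => mvfderiv 𝓘(ℝ, EM) ψ m (fundField G EM (Z n₀) m)) m₀
          (fundField G EM ζ m₀) +
        genCoord EG G EM m₀ m₀ (mvfderiv 𝓘(ℝ, EN) Z n₀ u') := by
    intro u Z hZ huZ u' ζ hu'
    have e1 : (fun n => mvfderiv 𝓘(ℝ, EN) (fun n => ψ (f n)) n (u n)) =ᶠ[𝓝 n₀]
        fun n => genCoord EG G EM m₀ (f n) (Z n) := by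
      filter_upwards [hchain] with n h
      rw [h, huZ]
      rfl
    rw [mvfderiv_congr_nhds e1]
    rw [mvfderiv_clm_apply_fun (A := fun n => genCoord EG G EM m₀ (f n)) (hb.comp n₀ hfd0) hZ]
    congr 1
    have e2 := mvfderiv_comp_fun (g := fun m => genCoord EG G EM m₀ m (Z n₀)) n₀
      (hb.clm_apply mdifferentiableAt_const) hfd0 u'
    rw [hu'] at e2
    exact e2
  have e1 := mvfderiv_mlieBracket hv hw hψf
  have e2 := mvfderiv_mlieBracket (mdifferentiableAt_fundField (EM := EM) G (X n₀) m₀)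
    (mdifferentiableAt_fundField (EM := EM) G (Y n₀) m₀) hψs
  rw [hchain.self_of_nhds, key w Y hY hwY _ _ (hvX n₀), key v X hX hvX _ _ (hwY n₀)] at e1
  have e3 : ∀ ζ, mvfderiv 𝓘(ℝ, EM) ψ m₀ (infGen EG G EM m₀ ζ) = genCoord EG G EM m₀ m₀ ζ :=
    fun _ => rfl
  have inj : ∀ u u' : TangentSpace 𝓘(ℝ, EM) m₀,
      mvfderiv 𝓘(ℝ, EM) ψ m₀ u = mvfderiv 𝓘(ℝ, EM) ψ m₀ u' → u = u' := fun u u' h =>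
    (mvfderiv_extChartAt_self m₀ u).symm.trans (h.trans (mvfderiv_extChartAt_self m₀ u'))
  apply inj
  rw [map_add, e2, e3, map_sub]
  refine e1.trans ?_
  abel

/-- The infinitesimal action intertwines the bracket of `𝔤` with the bracket of vector fields. -/
theorem mlieBracket_fundField (ξ η : EG) (m : M) :
    mlieBracket 𝓘(ℝ, EM) (fundField G EM ξ) (fundField G EM η) m =
      infGen EG G EM m (bracketR G ξ η) := by
  have hf : ContMDiff 𝓘(ℝ, EG) 𝓘(ℝ, EM) ∞ (fun g : G => g • m) :=
    ((contMDiff_smul (I := 𝓘(ℝ, EG)) (I' := 𝓘(ℝ, EM)) (n := ∞) (G := G) (M := M)).comp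
      (contMDiff_id.prodMk contMDiff_const))
  have := mfderiv_mlieBracket_aux (EM := EM) (f := fun g : G => g • m) (n₀ := 1)
    (v := fundField G EG ξ) (w := fundField G EG η) (X := fun _ => ξ) (Y := fun _ => η) G hf.contMDiffAt
    (mdifferentiableAt_fundField (EM := EG) G ξ 1) (mdifferentiableAt_fundField (EM := EG) G η 1)
    mdifferentiableAt_const mdifferentiableAt_const
    (fun g => mfderiv_orbit G m g ξ) (fun g => mfderiv_orbit G m g η)
  have h1 : (1 : G) • m = m := one_smul G m
  have h2 : (mlieBracket 𝓘(ℝ, EM) (fundField G EM ξ) (fundField G EM η) ((1 : G) • m) : EM) =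
      mlieBracket 𝓘(ℝ, EM) (fundField G EM ξ) (fundField G EM η) m :=
    congrArg (fun m => (mlieBracket 𝓘(ℝ, EM) (fundField G EM ξ) (fundField G EM η) m : EM)) h1
  refine h2.symm.trans ?_
  refine Eq.trans ?_ this.symm
  rw [mvfderiv_const, mvfderiv_const]
  simp

/-- The compatibility making the fibre product `A(f)` closed under the bracket. -/
theorem mfderiv_mlieBracket {f : N → M} {v w : ∀ n : N, TangentSpace 𝓘(ℝ, EN) n}
    {X Y : N → EG} {n₀ : N}
    (hf : ContMDiffAt 𝓘(ℝ, EN) 𝓘(ℝ, EM) ∞ f n₀)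
    (hv : MDifferentiableAt 𝓘(ℝ, EN) (𝓘(ℝ, EN).prod 𝓘(ℝ, EN))
      (fun x => (⟨x, v x⟩ : TangentBundle 𝓘(ℝ, EN) N)) n₀)
    (hw : MDifferentiableAt 𝓘(ℝ, EN) (𝓘(ℝ, EN).prod 𝓘(ℝ, EN))
      (fun x => (⟨x, w x⟩ : TangentBundle 𝓘(ℝ, EN) N)) n₀)
    (hX : MDifferentiableAt 𝓘(ℝ, EN) 𝓘(ℝ, EG) X n₀)
    (hY : MDifferentiableAt 𝓘(ℝ, EN) 𝓘(ℝ, EG) Y n₀)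
    (hvX : ∀ n, mfderiv 𝓘(ℝ, EN) 𝓘(ℝ, EM) f n (v n) = infGen EG G EM (f n) (X n))
    (hwY : ∀ n, mfderiv 𝓘(ℝ, EN) 𝓘(ℝ, EM) f n (w n) = infGen EG G EM (f n) (Y n)) :
    mfderiv 𝓘(ℝ, EN) 𝓘(ℝ, EM) f n₀ (mlieBracket 𝓘(ℝ, EN) v w n₀) =
      infGen EG G EM (f n₀) (mvfderiv 𝓘(ℝ, EN) Y n₀ (v n₀) - mvfderiv 𝓘(ℝ, EN) X n₀ (w n₀) +
        bracketR G (X n₀) (Y n₀)) := by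
  rw [map_add, ← mlieBracket_fundField]
  exact mfderiv_mlieBracket_aux G hf hv hw hX hY hvX hwY

end Action2

section LieAlg

set_option linter.unusedSectionVars false

variable {EG : Type*} [NormedAddCommGroup EG] [NormedSpace ℝ EG] [FiniteDimensional ℝ EG]
  (G : Type*) [TopologicalSpace G] [ChartedSpace EG G] [Group G] [LieGroup 𝓘(ℝ, EG) ∞ G]

theorem bracketR_add_left (ξ ξ' η : EG) :
    bracketR G (ξ + ξ') η = bracketR G ξ η + bracketR G ξ' η := by
  have : CompleteSpace EG := FiniteDimensional.complete ℝ EG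
  have h : (fundField G EG (ξ + ξ') : ∀ g : G, TangentSpace 𝓘(ℝ, EG) g) =
    fundField G EG ξ + fundField G EG ξ' := funext fun g => map_add _ _ _
  exact (congrArg (fun V : ∀ g : G, TangentSpace 𝓘(ℝ, EG) g =>
    (mlieBracket 𝓘(ℝ, EG) V (fundField G EG η) (1 : G) : EG)) h).trans
    (mlieBracket_add_left (W := fundField G EG η)
      (mdifferentiableAt_fundField (EM := EG) G ξ (1 : G))
      (mdifferentiableAt_fundField (EM := EG) G ξ' (1 : G)))

theorem bracketR_smul_left (c : ℝ) (ξ η : EG) :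
    bracketR G (c • ξ) η = c • bracketR G ξ η := by
  have : CompleteSpace EG := FiniteDimensional.complete ℝ EG
  have h : (fundField G EG (c • ξ) : ∀ g : G, TangentSpace 𝓘(ℝ, EG) g) =
    c • fundField G EG ξ := funext fun g => map_smul _ _ _
  exact (congrArg (fun V : ∀ g : G, TangentSpace 𝓘(ℝ, EG) g =>
    (mlieBracket 𝓘(ℝ, EG) V (fundField G EG η) (1 : G) : EG)) h).trans
    (mlieBracket_const_smul_left (W := fundField G EG η) (c := c)
      (mdifferentiableAt_fundField (EM := EG) G ξ (1 : G)))

theorem bracketR_swap (ξ η : EG) : bracketR G ξ η = -bracketR G η ξ :=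
  mlieBracket_swap_apply

/-- `bracketR` as a bilinear map. -/
noncomputable def bracketRL : EG →L[ℝ] EG →L[ℝ] EG :=
  LinearMap.toContinuousLinearMap ((LinearMap.toContinuousLinearMap :
    (EG →ₗ[ℝ] EG) ≃ₗ[ℝ] (EG →L[ℝ] EG)).toLinearMap ∘ₗ LinearMap.mk₂ ℝ (bracketR G)
      (bracketR_add_left G) (bracketR_smul_left G)
      (fun ξ η η' => by
        rw [bracketR_swap, bracketR_add_left, neg_add, ← bracketR_swap, ← bracketR_swap])
      (fun c ξ η => by
        rw [bracketR_swap, bracketR_smul_left, ← smul_neg, ← bracketR_swap]))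

theorem bracketRL_apply (ξ η : EG) : bracketRL G ξ η = bracketR G ξ η := rfl

theorem bracketR_jacobi (ξ η ζ : EG) : bracketR G ξ (bracketR G η ζ) =
    bracketR G (bracketR G ξ η) ζ + bracketR G η (bracketR G ξ ζ) := by
  have : CompleteSpace EG := FiniteDimensional.complete ℝ EG
  have : IsManifold 𝓘(ℝ, EG) (minSmoothness ℝ 3) G := by
    rw [minSmoothness_of_isRCLikeNormedField]
    have : IsManifold 𝓘(ℝ, EG) ∞ G := inferInstance
    exact IsManifold.of_le (n := ∞) (WithTop.coe_le_coe.2 (le_top : (3 : ℕ∞) ≤ ⊤))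
  have h : ∀ ξ η : EG, (mlieBracket 𝓘(ℝ, EG) (fundField G EG ξ) (fundField G EG η) :
      ∀ g : G, TangentSpace 𝓘(ℝ, EG) g) = fundField G EG (bracketR G ξ η) :=
    fun ξ η => funext fun g => mlieBracket_fundField G ξ η g
  have hs : ∀ ξ : EG, ContMDiffAt 𝓘(ℝ, EG) (𝓘(ℝ, EG).prod 𝓘(ℝ, EG)) (minSmoothness ℝ 2)
      (fun m : G => (⟨m, fundField G EG ξ m⟩ : TangentBundle 𝓘(ℝ, EG) G)) 1 := fun ξ =>
    ((contMDiff_fundField (EM := EG) G ξ) 1).of_le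
      (by rw [minSmoothness_of_isRCLikeNormedField]; exact ENat.LEInfty.out)
  have := leibniz_identity_mlieBracket_apply (hs ξ) (hs η) (hs ζ)
  rw [h η ζ, h ξ η, h ξ ζ, h ξ _, h _ ζ, h η _] at this
  exact ((infGen_one_right G _).symm.trans this).trans
    (congrArg₂ (fun a b : EG => a + b) (infGen_one_right G _) (infGen_one_right G _))

variable {G}

/-- The adjoint representation: `Ad_l` is the derivative at `1` of `g ↦ l g l⁻¹`. -/
noncomputable def Ad (l : G) : EG →L[ℝ] EG :=
  mfderiv 𝓘(ℝ, EG) 𝓘(ℝ, EG) (fun g : G => l * g * l⁻¹) 1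

theorem Ad_one (ξ : EG) : Ad (1 : G) ξ = ξ := by
  have h : (fun g : G => 1 * g * 1⁻¹) = id := by ext g; simp
  have : Ad (1 : G) = ContinuousLinearMap.id ℝ EG := by
    unfold Ad
    rw [h]
    exact mfderiv_id
  rw [this]; rfl

theorem Ad_mul (l k : G) (ξ : EG) : Ad (l * k) ξ = Ad l (Ad k ξ) := by
  have hs : ∀ l g : G, MDifferentiableAt 𝓘(ℝ, EG) 𝓘(ℝ, EG) (fun g : G => l * g * l⁻¹) g :=
    fun l g => ((contMDiff_const.mul contMDiff_id).mul contMDiff_const :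
      ContMDiff 𝓘(ℝ, EG) 𝓘(ℝ, EG) ∞ (fun g : G => l * g * l⁻¹)).mdifferentiableAt (by simp)
  have h := mfderiv_comp_apply (I := 𝓘(ℝ, EG)) (I' := 𝓘(ℝ, EG)) (I'' := 𝓘(ℝ, EG)) (1 : G)
    (hs l (k * 1 * k⁻¹)) (hs k 1) ξ
  have e : ((fun g : G => l * g * l⁻¹) ∘ fun g : G => k * g * k⁻¹) =
      fun g : G => (l * k) * g * (l * k)⁻¹ := by
    ext g; simp [mul_assoc]
  rw [e] at h
  refine h.trans ?_
  have e1 : k * 1 * k⁻¹ = 1 := by group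
  have e2 : ∀ g' : G, g' = 1 → ∀ u : EG,
      (mfderiv 𝓘(ℝ, EG) 𝓘(ℝ, EG) (fun g : G => l * g * l⁻¹) g' u : EG) = Ad l u := by
    rintro _ rfl u; rfl
  exact e2 _ e1 (Ad k ξ)

end LieAlg

section Sard

theorem exists_nhds_dense_compl_image {E F : Type*} [NormedAddCommGroup E] [NormedSpace ℝ E]
    [FiniteDimensional ℝ E] [NormedAddCommGroup F] [NormedSpace ℝ F] [FiniteDimensional ℝ F]
    (Φ : E → F) (x₀ : E) (hΦ : ContDiffAt ℝ 1 Φ x₀)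
    (hr : ∀ᶠ x in 𝓝 x₀, Module.finrank ℝ (LinearMap.range (fderiv ℝ Φ x).toLinearMap) ≤
      Module.finrank ℝ (LinearMap.range (fderiv ℝ Φ x₀).toLinearMap))
    (hlt : Module.finrank ℝ (LinearMap.range (fderiv ℝ Φ x₀).toLinearMap) <
      Module.finrank ℝ F) :
    ∃ V ∈ 𝓝 x₀, Dense (Φ '' V)ᶜ := by
  have : CompleteSpace E := FiniteDimensional.complete ℝ E
  set A := fderiv ℝ Φ x₀ with hA
  set R := LinearMap.range A.toLinearMap with hR
  set K := LinearMap.ker A.toLinearMap with hK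
  obtain ⟨pr₀, hpr₀⟩ := LinearMap.exists_leftInverse_of_injective R.subtype (Submodule.ker_subtype _)
  obtain ⟨q₀, hq₀⟩ := LinearMap.exists_leftInverse_of_injective K.subtype (Submodule.ker_subtype _)
  set pr : F →L[ℝ] R := LinearMap.toContinuousLinearMap pr₀ with hpr
  set q : E →L[ℝ] K := LinearMap.toContinuousLinearMap q₀ with hq
  have hprR : ∀ v : E, ((pr (A v) : R) : F) = A v := fun v =>
    congrArg Subtype.val (LinearMap.congr_fun hpr₀ ⟨A v, v, rfl⟩)
  have hqK : ∀ k : K, q (k : E) = k := fun k => LinearMap.congr_fun hq₀ k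
  set B : E →L[ℝ] R × K := (pr ∘L A).prod q with hB
  have hBinj : Function.Injective B := by
    rw [injective_iff_map_eq_zero]
    intro v hv
    have h1 : pr (A v) = 0 := congrArg Prod.fst hv
    have h2 : q v = 0 := congrArg Prod.snd hv
    have h3 : A v = 0 := by rw [← hprR, h1]; rfl
    have h4 : q v = ⟨v, h3⟩ := hqK ⟨v, h3⟩
    rw [h2] at h4
    exact (congrArg Subtype.val h4).symm
  have hdim : Module.finrank ℝ E = Module.finrank ℝ (R × K) := by
    rw [Module.finrank_prod]
    exact (LinearMap.finrank_range_add_finrank_ker A.toLinearMap).symm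
  have hBbij : Function.Bijective (B : E →ₗ[ℝ] R × K) :=
    ⟨hBinj, (LinearMap.injective_iff_surjective_of_finrank_eq_finrank hdim).1 hBinj⟩
  set Be : E ≃L[ℝ] R × K := (LinearEquiv.ofBijective _ hBbij).toContinuousLinearEquiv with hBe
  have hBe' : (Be : E →L[ℝ] R × K) = B := by ext v <;> rfl
  let h : E → R × K := fun x => (pr (Φ x), q x)
  have hh : ContDiffAt ℝ 1 h x₀ := (pr.contDiff.contDiffAt.comp x₀ hΦ).prodMk q.contDiff.contDiffAt
  have hh' : HasFDerivAt h (Be : E →L[ℝ] R × K) x₀ := by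
    rw [hBe']
    exact (pr.hasFDerivAt.comp x₀ (hΦ.differentiableAt (by simp)).hasFDerivAt).prodMk q.hasFDerivAt
  set e := hh.toOpenPartialHomeomorph h hh' (by simp) with he
  have hes : x₀ ∈ e.source := hh.mem_toOpenPartialHomeomorph_source hh' (by simp)
  have hecoe : ∀ x, e x = h x := fun _ => rfl
  have het : h x₀ ∈ e.target := e.map_source hes
  have hsymm : ContDiffAt ℝ 1 e.symm (h x₀) := by
    refine e.contDiffAt_symm (f₀' := Be) het ?_ ?_
    · rw [show e.symm (h x₀) = x₀ from e.left_inv hes]; exact hh'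
    · rw [show e.symm (h x₀) = x₀ from e.left_inv hes]; exact hh
  have hx₀ : e.symm (h x₀) = x₀ := e.left_inv hes
  have hcont : Tendsto e.symm (𝓝 (h x₀)) (𝓝 x₀) := by
    have := hsymm.continuousAt.tendsto
    rwa [hx₀] at this
  -- a good neighbourhood of `h x₀`
  have hgood : ∀ᶠ y in 𝓝 (h x₀), y ∈ e.target ∧ ContDiffAt ℝ 1 e.symm y ∧
      ContDiffAt ℝ 1 Φ (e.symm y) ∧
      Module.finrank ℝ (LinearMap.range (fderiv ℝ Φ (e.symm y)).toLinearMap) ≤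
        Module.finrank ℝ R :=
    Filter.Eventually.and (e.open_target.mem_nhds het) ((hsymm.eventually (by simp)).and
      ((hcont.eventually (hΦ.eventually (by simp))).and (hcont.eventually hr)))
  obtain ⟨ε, hε, hball⟩ := Metric.eventually_nhds_iff_ball.1 hgood
  set a₀ := (h x₀).1
  set b₀ := (h x₀).2
  have hprod : ∀ y ∈ Metric.ball a₀ ε ×ˢ Metric.ball b₀ ε, y ∈ Metric.ball (h x₀) ε := by
    intro y hy
    rw [← ball_prod_same] 
    exact hy
  let Ψ : R × K → F := fun y => Φ (e.symm y)
  have hΨ : ∀ y ∈ Metric.ball (h x₀) ε, ContDiffAt ℝ 1 Ψ y := fun y hy =>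
    (hball y hy).2.2.1.comp y (hball y hy).2.1
  have hΨ1 : ∀ y ∈ Metric.ball (h x₀) ε, pr (Ψ y) = y.1 := fun y hy =>
    congrArg Prod.fst (e.right_inv (hball y hy).1)
  have hker : ∀ y ∈ Metric.ball (h x₀) ε, ∀ k : K, fderiv ℝ Ψ y (0, k) = 0 := by
    intro y hy k
    have hd : HasFDerivAt Ψ (fderiv ℝ Ψ y) y := ((hΨ y hy).differentiableAt (by simp)).hasFDerivAt
    have hd2 : HasFDerivAt Ψ (fderiv ℝ Φ (e.symm y) ∘L fderiv ℝ e.symm y) y :=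
      (((hball y hy).2.2.1).differentiableAt (by simp)).hasFDerivAt.comp y
        (((hball y hy).2.1).differentiableAt (by simp)).hasFDerivAt
    have hsub : LinearMap.range (fderiv ℝ Ψ y).toLinearMap ≤
        LinearMap.range (fderiv ℝ Φ (e.symm y)).toLinearMap := by
      rintro _ ⟨u, rfl⟩
      exact ⟨fderiv ℝ e.symm y u, by rw [hd.unique hd2]; rfl⟩
    have hle : Module.finrank ℝ (LinearMap.range (fderiv ℝ Ψ y).toLinearMap) ≤
        Module.finrank ℝ R := (Submodule.finrank_mono hsub).trans (hball y hy).2.2.2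
    have hfst : ∀ u, pr (fderiv ℝ Ψ y u) = u.1 := by
      intro u
      have h1 : HasFDerivAt (fun y => pr (Ψ y)) (pr ∘L fderiv ℝ Ψ y) y := pr.hasFDerivAt.comp y hd
      have h2 : HasFDerivAt (fun y => pr (Ψ y)) (ContinuousLinearMap.fst ℝ R K) y := by
        refine hasFDerivAt_fst.congr_of_eventuallyEq ?_
        filter_upwards [Metric.isOpen_ball.mem_nhds hy] with z hz using hΨ1 z hz
      exact congrArg (fun L => L u) (h1.unique h2)
    -- `pr` is injective on the range of the derivative
    let P : LinearMap.range (fderiv ℝ Ψ y).toLinearMap →ₗ[ℝ] R :=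
      pr.toLinearMap ∘ₗ (LinearMap.range (fderiv ℝ Ψ y).toLinearMap).subtype
    have hPs : Function.Surjective P := fun a => ⟨⟨fderiv ℝ Ψ y (a, 0), ⟨_, rfl⟩⟩, hfst (a, 0)⟩
    have hge : Module.finrank ℝ R ≤
        Module.finrank ℝ (LinearMap.range (fderiv ℝ Ψ y).toLinearMap) :=
      LinearMap.finrank_le_finrank_of_surjective hPs
    have hPi : Function.Injective P :=
      (LinearMap.injective_iff_surjective_of_finrank_eq_finrank (le_antisymm hle hge)).2 hPs
    have h0 : P ⟨fderiv ℝ Ψ y (0, k), ⟨_, rfl⟩⟩ = P 0 := by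
      rw [map_zero]; exact hfst (0, k)
    exact congrArg Subtype.val (hPi h0)
  have hconst : ∀ a ∈ Metric.ball a₀ ε, ∀ b ∈ Metric.ball b₀ ε, Ψ (a, b) = Ψ (a, b₀) := by
    intro a ha b hb
    have hd : ∀ b ∈ Metric.ball b₀ ε, HasFDerivAt (fun b => Ψ (a, b)) (0 : K →L[ℝ] F) b := by
      intro b hb
      have hy := hprod (a, b) ⟨ha, hb⟩
      have h1 := ((hΨ _ hy).differentiableAt (by simp)).hasFDerivAt.comp b
        ((hasFDerivAt_const a b).prodMk (hasFDerivAt_id b))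
      convert! h1 using 1
      ext k
      exact (hker _ hy k).symm
    refine (convex_ball b₀ ε).is_const_of_fderivWithin_eq_zero (𝕜 := ℝ) (f := fun b => Ψ (a, b))
      (fun b hb => (hd b hb).differentiableAt.differentiableWithinAt) (fun b hb => ?_) hb
      (Metric.mem_ball_self hε)
    rw [fderivWithin_of_isOpen Metric.isOpen_ball hb, (hd b hb).fderiv]
  have hslice : ContDiffOn ℝ 1 (fun a => Ψ (a, b₀)) (Metric.ball a₀ ε) := by
    intro a ha
    have hy := hprod (a, b₀) ⟨ha, Metric.mem_ball_self hε⟩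
    exact (((hΨ _ hy).comp a (contDiffAt_id.prodMk contDiffAt_const))).contDiffWithinAt
  have hdense := hslice.dense_compl_image_of_dimH_lt_finrank (convex_ball _ _) subset_rfl (by
    rw [Real.dimH_of_mem_nhds (Metric.ball_mem_nhds a₀ hε)]
    exact_mod_cast hlt)
  refine ⟨e.source ∩ h ⁻¹' (Metric.ball (h x₀) ε), Filter.inter_mem (e.open_source.mem_nhds hes)
    (hh.continuousAt.preimage_mem_nhds (Metric.ball_mem_nhds _ hε)), hdense.mono ?_⟩
  refine compl_subset_compl.2 ?_
  rintro _ ⟨x, ⟨hxs, hx⟩, rfl⟩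
  have hx' : h x ∈ Metric.ball a₀ ε ×ˢ Metric.ball b₀ ε := by
    rw [ball_prod_same]; exact hx
  refine ⟨(h x).1, hx'.1, ?_⟩
  have := hconst _ hx'.1 _ hx'.2
  refine this.symm.trans ?_
  show Φ (e.symm (e x)) = Φ x
  rw [e.left_inv hxs]

variable {EG : Type*} [NormedAddCommGroup EG] [NormedSpace ℝ EG] [FiniteDimensional ℝ EG]
  (G : Type*) [TopologicalSpace G] [ChartedSpace EG G] [Group G] [LieGroup 𝓘(ℝ, EG) ∞ G]
  {EM : Type*} [NormedAddCommGroup EM] [NormedSpace ℝ EM] [FiniteDimensional ℝ EM]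
  {M : Type*} [TopologicalSpace M] [ChartedSpace EM M] [MulAction G M]
  [IsManifold 𝓘(ℝ, EM) ∞ M]
  [ContMDiffSMul 𝓘(ℝ, EG) 𝓘(ℝ, EM) ∞ G M] [MulAction.IsPretransitive G M]
  [T2Space M] [SecondCountableTopology G]

/-- A smooth transitive action is infinitesimally transitive. -/
theorem infGen_surjective (m : M) : Function.Surjective (infGen EG G EM m) := by
  have : IsManifold 𝓘(ℝ, EM) 1 M := inferInstance
  have : IsManifold 𝓘(ℝ, EG) ∞ G := inferInstance
  have : IsManifold 𝓘(ℝ, EG) 1 G := inferInstance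
  have : IsTopologicalGroup G := topologicalGroup_of_lieGroup 𝓘(ℝ, EG) ∞
  have : ContinuousSMul G M := ContMDiffSMul.continuousSMul (I := 𝓘(ℝ, EG)) (I' := 𝓘(ℝ, EM)) ∞
  have : LocallyCompactSpace M := Manifold.locallyCompact_of_finiteDimensional 𝓘(ℝ, EM)
  have : LocallyCompactSpace G := Manifold.locallyCompact_of_finiteDimensional 𝓘(ℝ, EG)
  by_contra hns
  let p : G → M := fun g => g • m
  have hp : ContMDiff 𝓘(ℝ, EG) 𝓘(ℝ, EM) ∞ p :=
    ((contMDiff_smul (I := 𝓘(ℝ, EG)) (I' := 𝓘(ℝ, EM)) (n := ∞) (G := G) (M := M)).comp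
      (contMDiff_id.prodMk contMDiff_const))
  have hact : ∀ g : G, ContMDiff 𝓘(ℝ, EM) 𝓘(ℝ, EM) ∞ (fun m : M => g • m) := fun g =>
    ((contMDiff_smul (I := 𝓘(ℝ, EG)) (I' := 𝓘(ℝ, EM)) (n := ∞) (G := G) (M := M)).comp
      (contMDiff_const.prodMk contMDiff_id))
  have hleft : ∀ g : G, ContMDiff 𝓘(ℝ, EG) 𝓘(ℝ, EG) ∞ (fun h : G => g * h) := fun g =>
    contMDiff_const.mul contMDiff_id
  -- the rank of `p` is constant
  set A : EG →L[ℝ] EM := infGen EG G EM m with hAdef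
  let D : G → EG →L[ℝ] EM := fun g => mfderiv 𝓘(ℝ, EG) 𝓘(ℝ, EM) p g
  have hrank : ∀ g : G, Module.finrank ℝ (LinearMap.range (D g).toLinearMap) ≤
      Module.finrank ℝ (LinearMap.range A.toLinearMap) := by
    intro g
    let L : EM →L[ℝ] EM := mfderiv 𝓘(ℝ, EM) 𝓘(ℝ, EM) (fun m : M => g • m) m
    let S : EG →L[ℝ] EG := mfderiv 𝓘(ℝ, EG) 𝓘(ℝ, EG) (fun h : G => g⁻¹ * h) g
    have hD : ∀ u : EG, D g u = L (A (S u)) := by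
      intro u
      have e1 : p = (fun m : M => g • m) ∘ (p ∘ fun h : G => g⁻¹ * h) := by
        ext h; simp [p, smul_smul]
      have hS := (hleft g⁻¹).mdifferentiableAt (x := g) (by simp)
      have d2 := mfderiv_comp_apply (I := 𝓘(ℝ, EG)) (I' := 𝓘(ℝ, EG)) (I'' := 𝓘(ℝ, EM)) g
        (hp.mdifferentiableAt (x := g⁻¹ * g) (by simp)) hS u
      have d1 := mfderiv_comp_apply (I := 𝓘(ℝ, EG)) (I' := 𝓘(ℝ, EM)) (I'' := 𝓘(ℝ, EM)) g
        ((hact g).mdifferentiableAt (x := p (g⁻¹ * g)) (by simp))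
        ((hp.mdifferentiableAt (x := g⁻¹ * g) (by simp)).comp g hS) u
      have c1 : ∀ g' : G, g' = 1 → ∀ w : EG,
          (mfderiv 𝓘(ℝ, EG) 𝓘(ℝ, EM) p g' w : EM) = A w := by
        rintro _ rfl w; rfl
      have c2 : ∀ m' : M, m' = m → ∀ w : EM,
          (mfderiv 𝓘(ℝ, EM) 𝓘(ℝ, EM) (fun m : M => g • m) m' w : EM) = L w := by
        rintro _ rfl w; rfl
      have f1 : (D g u : EM) = mfderiv 𝓘(ℝ, EG) 𝓘(ℝ, EM)
          ((fun m : M => g • m) ∘ (p ∘ fun h : G => g⁻¹ * h)) g u :=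
        congrArg (fun p : G → M => (mfderiv 𝓘(ℝ, EG) 𝓘(ℝ, EM) p g u : EM)) e1
      refine f1.trans (d1.trans ((c2 _ (by simp [p]) _).trans ?_))
      exact congrArg L (d2.trans (c1 _ (by simp) _))
    have : (D g).toLinearMap = L.toLinearMap ∘ₗ A.toLinearMap ∘ₗ S.toLinearMap :=
      LinearMap.ext hD
    rw [this, LinearMap.range_comp]
    refine (Submodule.finrank_map_le _ _).trans (Submodule.finrank_mono ?_)
    exact LinearMap.range_comp_le_range _ _
  have hlt : Module.finrank ℝ (LinearMap.range A.toLinearMap) < Module.finrank ℝ EM := by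
    refine Submodule.finrank_lt fun h => hns ?_
    exact LinearMap.range_eq_top.1 h
  -- pass to charts
  set χ := extChartAt 𝓘(ℝ, EG) (1 : G) with hχ
  set ψ := extChartAt 𝓘(ℝ, EM) m with hψ
  let y₀ : EG := χ 1
  have hχ1 : χ.symm y₀ = 1 := extChartAt_to_inv (1 : G)
  have hp1 : p 1 = m := one_smul G m
  let Φ : EG → EM := fun y => ψ (p (χ.symm y))
  have hsymmc : ContinuousAt χ.symm y₀ := continuousAt_extChartAt_symm (I := 𝓘(ℝ, EG)) (1 : G)
  have hsrc : ∀ᶠ y in 𝓝 y₀, y ∈ χ.target ∧ p (χ.symm y) ∈ (chartAt EM m).source := by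
    refine Filter.Eventually.and (extChartAt_target_mem_nhds (I := 𝓘(ℝ, EG)) (1 : G)) ?_
    refine (hp.continuous.continuousAt.comp hsymmc).preimage_mem_nhds ?_
    refine (chartAt EM m).open_source.mem_nhds ?_
    show p (χ.symm y₀) ∈ _
    rw [hχ1, hp1]
    exact mem_chart_source EM m
  have hχs : ∀ y ∈ χ.target, ContMDiffAt 𝓘(ℝ, EG) 𝓘(ℝ, EG) ∞ χ.symm y := fun y hy => by
    have := contMDiffWithinAt_extChartAt_symm_range (I := 𝓘(ℝ, EG)) (n := ∞) (1 : G) hy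
    simpa using! this
  have hψs : ∀ m' ∈ (chartAt EM m).source, ContMDiffAt 𝓘(ℝ, EM) 𝓘(ℝ, EM) ∞ ψ m' :=
    fun m' hm' => contMDiffAt_extChartAt' hm'
  have hΦ : ContDiffAt ℝ 1 Φ y₀ := by
    have h0 := hsrc.self_of_nhds
    have : ContMDiffAt 𝓘(ℝ, EG) 𝓘(ℝ, EM) ∞ Φ y₀ :=
      (hψs _ h0.2).comp y₀ ((hp _).comp y₀ (hχs _ h0.1))
    exact this.contDiffAt.of_le (by exact_mod_cast le_top)
  have hfd : ∀ y, y ∈ χ.target → p (χ.symm y) ∈ (chartAt EM m).source → ∀ u : EG,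
      fderiv ℝ Φ y u = mvfderiv 𝓘(ℝ, EM) ψ (p (χ.symm y)) (D (χ.symm y)
        (mfderiv 𝓘(ℝ, EG) 𝓘(ℝ, EG) χ.symm y u)) := by
    intro y hy hy' u
    have m1 := (hχs y hy).mdifferentiableAt (by simp)
    have m2 := hp.mdifferentiableAt (x := χ.symm y) (by simp)
    have m3 := (hψs _ hy').mdifferentiableAt (by simp)
    have e1 := mvfderiv_comp_fun (f := p ∘ χ.symm) y m3 (m2.comp y m1) u
    have e2 := mfderiv_comp_apply (I := 𝓘(ℝ, EG)) (I' := 𝓘(ℝ, EG)) (I'' := 𝓘(ℝ, EM)) y m2 m1 u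
    exact (mvfderiv_vectorSpace Φ y u).symm.trans
      (e1.trans (congrArg (mvfderiv 𝓘(ℝ, EM) ψ (p (χ.symm y))) e2))
  have hle : ∀ᶠ y in 𝓝 y₀, Module.finrank ℝ (LinearMap.range (fderiv ℝ Φ y).toLinearMap) ≤
      Module.finrank ℝ (LinearMap.range A.toLinearMap) := by
    filter_upwards [hsrc] with y hy
    let P : EM →ₗ[ℝ] EM := (mvfderiv 𝓘(ℝ, EM) ψ (p (χ.symm y)) : EM →L[ℝ] EM).toLinearMap
    let S : EG →ₗ[ℝ] EG := (mfderiv 𝓘(ℝ, EG) 𝓘(ℝ, EG) χ.symm y : EG →L[ℝ] EG).toLinearMap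
    have : (fderiv ℝ Φ y).toLinearMap = P ∘ₗ (D (χ.symm y)).toLinearMap ∘ₗ S :=
      LinearMap.ext (hfd y hy.1 hy.2)
    rw [this, LinearMap.range_comp]
    refine (Submodule.finrank_map_le _ _).trans ((Submodule.finrank_mono ?_).trans (hrank (χ.symm y)))
    exact LinearMap.range_comp_le_range _ _
  have hge : Module.finrank ℝ (LinearMap.range A.toLinearMap) ≤
      Module.finrank ℝ (LinearMap.range (fderiv ℝ Φ y₀).toLinearMap) := by
    have h0 := hsrc.self_of_nhds
    refine Submodule.finrank_mono ?_
    rintro _ ⟨u, rfl⟩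
    refine ⟨u, ?_⟩
    refine (hfd y₀ h0.1 h0.2 u).trans ?_
    have c0 : (mfderiv 𝓘(ℝ, EG) 𝓘(ℝ, EG) χ.symm y₀ u : EG) = u := by
      have h1 : mfderivWithin 𝓘(ℝ, EG) 𝓘(ℝ, EG) χ.symm (range 𝓘(ℝ, EG)) y₀ =
        mfderiv 𝓘(ℝ, EG) 𝓘(ℝ, EG) χ.symm y₀ := by simp [mfderivWithin_univ]
      have h2 : (mfderivWithin 𝓘(ℝ, EG) 𝓘(ℝ, EG) χ.symm (range 𝓘(ℝ, EG)) y₀ : EG →L[ℝ] EG) =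
        ContinuousLinearMap.id ℝ EG := mfderivWithin_range_extChartAt_symm
      exact (congrArg (fun L : EG →L[ℝ] EG => L u) h1).symm.trans
        (congrArg (fun L : EG →L[ℝ] EG => L u) h2)
    have c1 : ∀ g' : G, g' = 1 → ∀ w : EG, (mvfderiv 𝓘(ℝ, EM) ψ (p g') (D g' w) : EM) = A w := by
      rintro _ rfl w
      have c2 : ∀ m' : M, m' = m → ∀ w : EM,
          (mvfderiv 𝓘(ℝ, EM) ψ m' w : EM) = w := by
        rintro _ rfl w; exact mvfderiv_extChartAt_self _ w
      exact c2 _ hp1 _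
    exact (c1 _ hχ1 _).trans (congrArg A c0)
  obtain ⟨V, hV, hdense⟩ := exists_nhds_dense_compl_image Φ y₀ hΦ
    (hle.mono fun y hy => hy.trans hge) (hle.self_of_nhds.trans_lt hlt)
  -- an open subset of `M` is contained in the image of `V`
  have hopen : IsOpenMap p := isOpenMap_smul_of_sigmaCompact m
  have hN : {g : G | g ∈ χ.source ∧ χ g ∈ V ∧ p g ∈ (chartAt EM m).source} ∈ 𝓝 (1 : G) := by
    refine Filter.Eventually.and (extChartAt_source_mem_nhds (I := 𝓘(ℝ, EG)) (1 : G))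
      (Filter.Eventually.and ?_ ?_)
    · exact (continuousAt_extChartAt (I := 𝓘(ℝ, EG)) (1 : G)).preimage_mem_nhds hV
    · refine hp.continuous.continuousAt.preimage_mem_nhds ?_
      refine (chartAt EM m).open_source.mem_nhds ?_
      rw [hp1]
      exact mem_chart_source EM m
  have hO := hopen.image_mem_nhds hN
  rw [hp1] at hO
  have hO2 : ψ '' (p '' {g : G | g ∈ χ.source ∧ χ g ∈ V ∧ p g ∈ (chartAt EM m).source}) ∈
      𝓝 (ψ m) := by
    have := extChartAt_image_nhds_mem_nhds_of_boundaryless (I := 𝓘(ℝ, EM)) hO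
    exact this
  obtain ⟨z, hz1, hz2⟩ := hdense.inter_nhds_nonempty hO2
  obtain ⟨_, ⟨g, hg, rfl⟩, rfl⟩ := hz2
  refine hz1 ⟨χ g, hg.2.1, ?_⟩
  show ψ (p (χ.symm (χ g))) = ψ (p g)
  rw [χ.left_inv hg.1]

end Sard

universe w

/-- A Lie algebroid over the manifold `S`: a smooth vector bundle (of finite rank), an anchor
`# : A → TS` and a Lie bracket on smooth sections satisfying the Leibniz rule. -/
structure LieAlgebroid (ES : Type*) [NormedAddCommGroup ES] [NormedSpace ℝ ES]
    (S : Type*) [TopologicalSpace S] [ChartedSpace ES S] [IsManifold 𝓘(ℝ, ES) ∞ S] where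
  rank : ℕ
  Fib : S → Type w
  [addCommGroup : ∀ x, AddCommGroup (Fib x)]
  [module : ∀ x, Module ℝ (Fib x)]
  [topTotal : TopologicalSpace (TotalSpace (EuclideanSpace ℝ (Fin rank)) Fib)]
  [topFib : ∀ x, TopologicalSpace (Fib x)]
  [fiberBundle : FiberBundle (EuclideanSpace ℝ (Fin rank)) Fib]
  [vectorBundle : VectorBundle ℝ (EuclideanSpace ℝ (Fin rank)) Fib]
  [smoothBundle : ContMDiffVectorBundle ∞ (EuclideanSpace ℝ (Fin rank)) Fib 𝓘(ℝ, ES)]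
  anchor : ∀ x, Fib x →ₗ[ℝ] TangentSpace 𝓘(ℝ, ES) x
  anchor_smooth : ContMDiff (𝓘(ℝ, ES).prod 𝓘(ℝ, EuclideanSpace ℝ (Fin rank)))
    (𝓘(ℝ, ES).prod 𝓘(ℝ, ES)) ∞
    (fun p : TotalSpace (EuclideanSpace ℝ (Fin rank)) Fib =>
      (⟨p.1, anchor p.1 p.2⟩ : TangentBundle 𝓘(ℝ, ES) S))
  bracket : Cₛ^∞⟮𝓘(ℝ, ES); EuclideanSpace ℝ (Fin rank), Fib⟯ →
    Cₛ^∞⟮𝓘(ℝ, ES); EuclideanSpace ℝ (Fin rank), Fib⟯ →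
    Cₛ^∞⟮𝓘(ℝ, ES); EuclideanSpace ℝ (Fin rank), Fib⟯
  bracket_add : ∀ X Y Z, bracket X (Y + Z) = bracket X Y + bracket X Z
  bracket_const_smul : ∀ (c : ℝ) X Y, bracket X (c • Y) = c • bracket X Y
  bracket_swap : ∀ X Y, bracket X Y = -bracket Y X
  jacobi : ∀ X Y Z, bracket X (bracket Y Z) = bracket (bracket X Y) Z + bracket Y (bracket X Z)
  /-- The Leibniz rule `[X, gY] = g[X, Y] + (#X · g) Y`. -/
  leibniz : ∀ (X Y Y' : Cₛ^∞⟮𝓘(ℝ, ES); EuclideanSpace ℝ (Fin rank), Fib⟯) (g : S → ℝ),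
    ContMDiff 𝓘(ℝ, ES) 𝓘(ℝ, ℝ) ∞ g → (∀ x, Y' x = g x • Y x) →
    ∀ x, bracket X Y' x = g x • bracket X Y x + (mvfderiv 𝓘(ℝ, ES) g x (anchor x (X x))) • Y x
  /-- The anchor is a homomorphism to the Lie algebra of vector fields. -/
  anchor_bracket : ∀ X Y x, anchor x (bracket X Y x) =
    mlieBracket 𝓘(ℝ, ES) (fun y => anchor y (X y)) (fun y => anchor y (Y y)) x

namespace LieAlgebroid

attribute [instance] addCommGroup module topTotal topFib fiberBundle vectorBundle smoothBundle

variable {ES : Type*} [NormedAddCommGroup ES] [NormedSpace ℝ ES]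
  {S : Type*} [TopologicalSpace S] [ChartedSpace ES S] [IsManifold 𝓘(ℝ, ES) ∞ S]

/-- The model fibre. -/
abbrev Model (A : LieAlgebroid.{w} ES S) : Type := EuclideanSpace ℝ (Fin A.rank)

/-- The total space. -/
abbrev Total (A : LieAlgebroid.{w} ES S) : Type _ := TotalSpace A.Model A.Fib

/-- The smooth sections. -/
abbrev Sections (A : LieAlgebroid.{w} ES S) : Type _ := Cₛ^∞⟮𝓘(ℝ, ES); A.Model, A.Fib⟯

/-- Lie algebroid morphisms covering the identity of the base. -/
structure Hom (A B : LieAlgebroid.{w} ES S) where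
  toFun : ∀ x, A.Fib x →ₗ[ℝ] B.Fib x
  smooth : ContMDiff (𝓘(ℝ, ES).prod 𝓘(ℝ, A.Model)) (𝓘(ℝ, ES).prod 𝓘(ℝ, B.Model)) ∞
    (fun p : A.Total => (⟨p.1, toFun p.1 p.2⟩ : B.Total))
  anchor_toFun : ∀ x a, B.anchor x (toFun x a) = A.anchor x a
  /-- `[λ∘X, λ∘Y] = λ∘[X, Y]` for all smooth sections `X`, `Y`. -/
  bracket_toFun : ∀ (X Y : A.Sections) (X' Y' : B.Sections),
    (∀ x, X' x = toFun x (X x)) → (∀ x, Y' x = toFun x (Y x)) →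
    ∀ x, B.bracket X' Y' x = toFun x (A.bracket X Y x)

/-- The image of a section under a morphism. -/
noncomputable def Hom.mapSection {A B : LieAlgebroid.{w} ES S} (φ : Hom A B) (X : A.Sections) : B.Sections where
  toFun x := φ.toFun x (X x)
  contMDiff_toFun := φ.smooth.comp X.contMDiff

/-- The identity morphism. -/
noncomputable def Hom.id (A : LieAlgebroid.{w} ES S) : Hom A A where
  toFun _ := LinearMap.id
  smooth := contMDiff_id
  anchor_toFun _ _ := rfl
  bracket_toFun X Y X' Y' hX hY x := by
    have h1 : X' = X := ContMDiffSection.ext hX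
    have h2 : Y' = Y := ContMDiffSection.ext hY
    rw [h1, h2]; rfl

/-- Composition of morphisms. -/
noncomputable def Hom.comp {A B C : LieAlgebroid.{w} ES S} (ψ : Hom B C) (φ : Hom A B) : Hom A C where
  toFun x := ψ.toFun x ∘ₗ φ.toFun x
  smooth := ψ.smooth.comp φ.smooth
  anchor_toFun x a := (ψ.anchor_toFun x _).trans (φ.anchor_toFun x a)
  bracket_toFun X Y X' Y' hX hY x := by
    rw [ψ.bracket_toFun (φ.mapSection X) (φ.mapSection Y) X' Y' hX hY x,
      φ.bracket_toFun X Y (φ.mapSection X) (φ.mapSection Y) (fun _ => rfl) (fun _ => rfl) x]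
    rfl

@[ext]
theorem Hom.ext {A B : LieAlgebroid.{w} ES S} {φ ψ : Hom A B} (h : ∀ x, φ.toFun x = ψ.toFun x) :
    φ = ψ := by
  cases φ; cases ψ
  congr 1
  exact funext h

end LieAlgebroid

/-- The objects of the category of (generalized) Maurer-Cartan forms on `S`, relative to the action
of `G` on `M`: a Lie algebroid morphism `ω : A → 𝔤` (that is, a smooth fibrewise linear map
satisfying the Maurer-Cartan equation) which is transitive, injective on isotropy algebras, and maps
some isotropy algebra of `A` into a stabilizer of the action of `𝔤` on `M`. -/
structure MCForm (EG : Type*) [NormedAddCommGroup EG] [NormedSpace ℝ EG]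
    (G : Type*) [TopologicalSpace G] [ChartedSpace EG G] [Group G]
    (EM : Type*) [NormedAddCommGroup EM] [NormedSpace ℝ EM]
    (M : Type*) [TopologicalSpace M] [ChartedSpace EM M] [MulAction G M]
    (ES : Type*) [NormedAddCommGroup ES] [NormedSpace ℝ ES]
    (S : Type*) [TopologicalSpace S] [ChartedSpace ES S] [IsManifold 𝓘(ℝ, ES) ∞ S] where
  alg : LieAlgebroid.{w} ES S
  form : ∀ x, alg.Fib x →ₗ[ℝ] EG
  form_smooth : ContMDiff (𝓘(ℝ, ES).prod 𝓘(ℝ, alg.Model)) 𝓘(ℝ, EG) ∞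
    (fun p : alg.Total => form p.1 p.2)
  /-- `ω[X, Y] = #X · ω(Y) - #Y · ω(X) + [ω(X), ω(Y)]` for all smooth sections `X`, `Y`: `ω` is a
  morphism of Lie algebroids from `alg` to the Lie algebra `𝔤`. -/
  form_bracket : ∀ (X Y : alg.Sections) (x : S), form x (alg.bracket X Y x) =
    mvfderiv 𝓘(ℝ, ES) (fun y => form y (Y y)) x (alg.anchor x (X x)) -
      mvfderiv 𝓘(ℝ, ES) (fun y => form y (X y)) x (alg.anchor x (Y x)) +
      bracketR G (form x (X x)) (form x (Y x))
  /-- The algebroid is transitive. -/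
  transitive : ∀ x, Function.Surjective (alg.anchor x)
  /-- `ω` is injective on the isotropy algebras. -/
  injective : ∀ x a b, alg.anchor x a = 0 → alg.anchor x b = 0 → form x a = form x b → a = b
  /-- Some isotropy algebra is mapped into a stabilizer. -/
  exists_stabilizer : ∃ (x₀ : S) (m₀ : M),
    ∀ a, alg.anchor x₀ a = 0 → infGen EG G EM m₀ (form x₀ a) = 0

namespace MCForm

variable {EG : Type*} [NormedAddCommGroup EG] [NormedSpace ℝ EG] [FiniteDimensional ℝ EG]
  {G : Type*} [TopologicalSpace G] [ChartedSpace EG G] [Group G]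
  {EM : Type*} [NormedAddCommGroup EM] [NormedSpace ℝ EM]
  {M : Type*} [TopologicalSpace M] [ChartedSpace EM M] [MulAction G M]
  {ES : Type*} [NormedAddCommGroup ES] [NormedSpace ℝ ES]
  {S : Type*} [TopologicalSpace S] [ChartedSpace ES S] [IsManifold 𝓘(ℝ, ES) ∞ S]

/-- A morphism of Maurer-Cartan forms: a Lie algebroid morphism over the identity and an element
`l ∈ G` making the square with `Ad_l` commute. -/
@[ext]
structure Hom (θ₁ θ₂ : MCForm.{w} EG G EM M ES S) where
  map : LieAlgebroid.Hom θ₁.alg θ₂.alg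
  l : G
  comm : ∀ x a, θ₂.form x (map.toFun x a) = Ad l (θ₁.form x a)

variable [LieGroup 𝓘(ℝ, EG) ∞ G]

/-- The category of Maurer-Cartan forms. -/
noncomputable instance : CategoryTheory.Category (MCForm.{w} EG G EM M ES S) where
  Hom := Hom
  id _ := ⟨LieAlgebroid.Hom.id _, 1, fun x a => (Ad_one _).symm⟩
  comp f g := ⟨g.map.comp f.map, g.l * f.l, fun x a => by
    rw [Ad_mul, ← f.comm, ← g.comm]; rfl⟩
  id_comp f := Hom.ext rfl (mul_one _)
  comp_id f := Hom.ext rfl (one_mul _)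
  assoc f g h := Hom.ext rfl (mul_assoc _ _ _).symm

end MCForm

section Pullback

set_option linter.unusedSectionVars false

variable {EG : Type*} [NormedAddCommGroup EG] [NormedSpace ℝ EG]
  (G : Type*) [TopologicalSpace G] [ChartedSpace EG G] [Group G]
  {EM : Type*} [NormedAddCommGroup EM] [NormedSpace ℝ EM]
  {M : Type*} [TopologicalSpace M] [ChartedSpace EM M] [MulAction G M]
  {ES : Type*} [NormedAddCommGroup ES] [NormedSpace ℝ ES]
  {S : Type*} [TopologicalSpace S] [ChartedSpace ES S]
  {EN : Type*} [NormedAddCommGroup EN] [NormedSpace ℝ EN] {HN : Type*} [TopologicalSpace HN]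
  {IN : ModelWithCorners ℝ EN HN} {N : Type*} [TopologicalSpace N] [ChartedSpace HN N]

variable (EG ES S) in
/-- The vector bundle `(𝔤 × S) ⊕ TS` over `S`. -/
abbrev Ambient : S → Type _ := (Bundle.Trivial S EG) ×ᵇ (TangentSpace 𝓘(ℝ, ES) : S → Type _)

/-- The fibre over `x` of the pullback `A(f)` of the action algebroid `𝔤 × M` along `f`: all pairs
`(ξ, v) ∈ 𝔤 × T_x S` with `ξ†(f x) = Tf v`. -/
def pullbackFiber (f : S → M) (x : S) : Submodule ℝ (Ambient EG ES S x) where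
  carrier := {p | infGen EG G EM (f x) p.1 = mfderiv 𝓘(ℝ, ES) 𝓘(ℝ, EM) f x p.2}
  add_mem' {p q} hp hq := by
    show infGen EG G EM (f x) (p.1 + q.1) = mfderiv 𝓘(ℝ, ES) 𝓘(ℝ, EM) f x (p.2 + q.2)
    exact (map_add (infGen EG G EM (f x)) _ _).trans ((congrArg₂ (· + ·) hp hq).trans
      (map_add (mfderiv 𝓘(ℝ, ES) 𝓘(ℝ, EM) f x) _ _).symm)
  zero_mem' := (map_zero (infGen EG G EM (f x))).trans
    (map_zero (mfderiv 𝓘(ℝ, ES) 𝓘(ℝ, EM) f x)).symm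
  smul_mem' c p hp := 
    (map_smul (infGen EG G EM (f x)) c _).trans ((congrArg (c • ·) hp).trans
      (map_smul (mfderiv 𝓘(ℝ, ES) 𝓘(ℝ, EM) f x) c _).symm)

theorem contMDiffAt_coord [IsManifold 𝓘(ℝ, EM) ∞ M] {f : N → M}
    {v : ∀ n, TangentSpace 𝓘(ℝ, EM) (f n)} {n : N} (m₀ : M)
    (hn : f n ∈ (chartAt EM m₀).source)
    (h : ContMDiffAt IN (𝓘(ℝ, EM).prod 𝓘(ℝ, EM)) ∞
      (fun n => (⟨f n, v n⟩ : TangentBundle 𝓘(ℝ, EM) M)) n) :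
    ContMDiffAt IN 𝓘(ℝ, EM) ∞
      (fun n => mvfderiv 𝓘(ℝ, EM) (extChartAt 𝓘(ℝ, EM) m₀) (f n) (v n)) n := by
  have h2 := ((trivializationAt EM (TangentSpace 𝓘(ℝ, EM)) m₀).contMDiffAt_iff
    (IB := 𝓘(ℝ, EM)) (n := ∞) (f := fun n => (⟨f n, v n⟩ : TangentBundle 𝓘(ℝ, EM) M))
    (by rw [Trivialization.mem_source]; exact hn)).1 h
  refine h2.2.congr_of_eventuallyEq ?_
  filter_upwards [h2.1.continuousAt.preimage_mem_nhds
    ((chartAt EM m₀).open_source.mem_nhds hn)] with n hn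
  have h1 := TangentBundle.continuousLinearMapAt_trivializationAt (I := 𝓘(ℝ, EM)) hn
  refine (congrArg (fun L : TangentSpace 𝓘(ℝ, EM) (f n) →L[ℝ] EM => L (v n)) h1).symm.trans ?_
  show (trivializationAt EM (TangentSpace 𝓘(ℝ, EM)) m₀).continuousLinearMapAt ℝ (f n) (v n) = _
  rw [Trivialization.continuousLinearMapAt_apply, Trivialization.linearMapAt_apply, if_pos]
  exact hn

variable [IsManifold 𝓘(ℝ, ES) ∞ S]

theorem contMDiffAt_ambient_iff {g : N → TotalSpace (EG × ES) (Ambient EG ES S)} {n : N} :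
    ContMDiffAt IN (𝓘(ℝ, ES).prod 𝓘(ℝ, EG × ES)) ∞ g n ↔
      ContMDiffAt IN 𝓘(ℝ, EG) ∞ (fun n => ((g n).2.1 : EG)) n ∧
      ContMDiffAt IN (𝓘(ℝ, ES).prod 𝓘(ℝ, ES)) ∞
        (fun n => (⟨(g n).1, (g n).2.2⟩ : TangentBundle 𝓘(ℝ, ES) S)) n := by
  rw [contMDiffAt_totalSpace, contMDiffAt_totalSpace]
  constructor
  · rintro ⟨h1, h2⟩
    have a := (contMDiffAt_const (c := ContinuousLinearMap.fst ℝ EG ES)).clm_apply h2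
    have b := (contMDiffAt_const (c := ContinuousLinearMap.snd ℝ EG ES)).clm_apply h2
    exact ⟨a, h1, b⟩
  · rintro ⟨h1, h2, h3⟩
    exact ⟨h2, h1.prodMk_space h3⟩

theorem contMDiff_ambient_iff {g : N → TotalSpace (EG × ES) (Ambient EG ES S)} :
    ContMDiff IN (𝓘(ℝ, ES).prod 𝓘(ℝ, EG × ES)) ∞ g ↔
      ContMDiff IN 𝓘(ℝ, EG) ∞ (fun n => ((g n).2.1 : EG)) ∧
      ContMDiff IN (𝓘(ℝ, ES).prod 𝓘(ℝ, ES)) ∞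
        (fun n => (⟨(g n).1, (g n).2.2⟩ : TangentBundle 𝓘(ℝ, ES) S)) :=
  ⟨fun h => ⟨fun n => (contMDiffAt_ambient_iff.1 (h n)).1,
    fun n => (contMDiffAt_ambient_iff.1 (h n)).2⟩,
    fun h n => contMDiffAt_ambient_iff.2 ⟨h.1 n, h.2 n⟩⟩

theorem contMDiffOn_clm_of_apply {E F : Type*} [NormedAddCommGroup E] [NormedSpace ℝ E]
    [FiniteDimensional ℝ E] [NormedAddCommGroup F] [NormedSpace ℝ F] {T : S → E →L[ℝ] F} {U : Set S}
    (h : ∀ u, ContMDiffOn 𝓘(ℝ, ES) 𝓘(ℝ, F) ∞ (fun x => T x u) U) :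
    ContMDiffOn 𝓘(ℝ, ES) 𝓘(ℝ, E →L[ℝ] F) ∞ T U := by
  let b := Module.finBasis ℝ E
  have hT : T = fun x => ∑ i, ContinuousLinearMap.smulRightL ℝ E F
      (LinearMap.toContinuousLinearMap (b.coord i)) (T x (b i)) := by
    ext x u
    conv_lhs => rw [← b.sum_repr u, map_sum]
    simp
  rw [hT]
  refine contMDiffOn_finsetSum fun i _ => ?_
  exact contMDiffOn_const.clm_apply (h (b i))

section Bundle

variable [FiniteDimensional ℝ EG] [FiniteDimensional ℝ EM] [FiniteDimensional ℝ ES]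
  [LieGroup 𝓘(ℝ, EG) ∞ G] [IsManifold 𝓘(ℝ, EM) ∞ M]
  [ContMDiffSMul 𝓘(ℝ, EG) 𝓘(ℝ, EM) ∞ G M] [MulAction.IsPretransitive G M]
  [T2Space M] [SecondCountableTopology G]

variable (EG EM ES) in
/-- The rank of `A(f)`. -/
noncomputable abbrev pullbackRank : ℕ :=
  Module.finrank ℝ EG + Module.finrank ℝ ES - Module.finrank ℝ EM

theorem exists_chart {f : S → M} (hf : ContMDiff 𝓘(ℝ, ES) 𝓘(ℝ, EM) ∞ f) (x₀ : S) :
    Nonempty (KernelBundle.Chart (EB := ES) (EG × ES) EM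
      (EuclideanSpace ℝ (Fin (pullbackRank EG EM ES)))
      (pullbackFiber (EG := EG) (EM := EM) (ES := ES) G f) x₀) := by
  have : IsManifold 𝓘(ℝ, EM) 1 M := inferInstance
  set ψ := extChartAt 𝓘(ℝ, EM) (f x₀) with hψ
  let e := trivializationAt ES (TangentSpace 𝓘(ℝ, ES) : S → Type _) x₀
  let U : Set S := e.baseSet ∩ f ⁻¹' (chartAt EM (f x₀)).source
  have hU : IsOpen U := e.open_baseSet.inter
    ((chartAt EM (f x₀)).open_source.preimage hf.continuous)
  have hx₀ : x₀ ∈ U := ⟨mem_baseSet_trivializationAt ES _ x₀, mem_chart_source EM (f x₀)⟩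
  let T : S → (EG × ES) →L[ℝ] EM := fun x =>
    (genCoord EG G EM (f x₀) (f x)) ∘L (ContinuousLinearMap.fst ℝ EG ES) -
    (mvfderiv 𝓘(ℝ, EM) ψ (f x) ∘L mfderiv 𝓘(ℝ, ES) 𝓘(ℝ, EM) f x ∘L e.symmL ℝ x) ∘L
      (ContinuousLinearMap.snd ℝ EG ES)
  have hT : ∀ x u, T x u = genCoord EG G EM (f x₀) (f x) u.1 -
    mvfderiv 𝓘(ℝ, EM) ψ (f x) (mfderiv 𝓘(ℝ, ES) 𝓘(ℝ, EM) f x (e.symmL ℝ x u.2)) := fun _ _ => rfl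
  have hsurj : ∀ m : M, Function.Surjective (infGen EG G EM m) := infGen_surjective G
  have hdim : Module.finrank ℝ EM ≤ Module.finrank ℝ EG :=
    LinearMap.finrank_le_finrank_of_surjective (f := (infGen EG G EM (f x₀) : EG →L[ℝ] EM).toLinearMap)
      (hsurj (f x₀))
  refine KernelBundle.Chart.exists_of_surjective ?_ x₀ U hU hx₀ ?_ T ?_ ?_ ?_
  · rw [finrank_euclideanSpace_fin, Module.finrank_prod]
    show _ = _ + (Module.finrank ℝ EG + Module.finrank ℝ ES - Module.finrank ℝ EM)
    omega
  · intro x hx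
    exact ⟨mem_univ x, hx.1⟩
  · refine contMDiffOn_clm_of_apply fun u => ?_
    simp only [hT]
    refine ContMDiffOn.sub ?_ ?_
    · intro x hx
      refine (contMDiffAt_coord (f x₀) hx.2 ?_).contMDiffWithinAt
      exact contMDiffAt_infGen G (hf x) contMDiffAt_const
    · intro x hx
      refine (contMDiffAt_coord (f x₀) hx.2 ?_).contMDiffWithinAt
      have h1 : ContMDiffAt 𝓘(ℝ, ES) (𝓘(ℝ, ES).prod 𝓘(ℝ, ES)) ∞
          (fun x => (⟨x, e.symmL ℝ x u.2⟩ : TangentBundle 𝓘(ℝ, ES) S)) x := by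
        refine (e.contMDiffAt_iff (by rw [Trivialization.mem_source]; exact hx.1)).2
          ⟨contMDiffAt_id, ?_⟩
        refine (contMDiffAt_const (c := u.2)).congr_of_eventuallyEq ?_
        filter_upwards [e.open_baseSet.mem_nhds hx.1] with y hy
        have := e.continuousLinearMapAt_symmL (R := ℝ) hy u.2
        rwa [Trivialization.continuousLinearMapAt_apply, Trivialization.linearMapAt_apply,
          if_pos hy] at this
      exact (hf.contMDiff_tangentMap (m := ∞) (by simp)).contMDiffAt.comp x h1
  · intro z
    obtain ⟨ξ, hξ⟩ := hsurj (f x₀) z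
    refine ⟨(ξ, 0), ?_⟩
    rw [hT]
    have h0 : mvfderiv 𝓘(ℝ, EM) ψ (f x₀) (mfderiv 𝓘(ℝ, ES) 𝓘(ℝ, EM) f x₀
      (e.symmL ℝ x₀ ((ξ, (0 : ES)) : EG × ES).2)) = 0 := by
      show mvfderiv 𝓘(ℝ, EM) ψ (f x₀) (mfderiv 𝓘(ℝ, ES) 𝓘(ℝ, EM) f x₀ (e.symmL ℝ x₀ 0)) = 0
      rw [map_zero, map_zero, map_zero]
    rw [h0, sub_zero]
    refine Eq.trans ?_ hξ
    exact mvfderiv_extChartAt_self (f x₀) _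
  · intro x hx v
    have hxe : x ∈ e.baseSet := hx.1
    have hv1 : (((trivializationAt (EG × ES) (Ambient EG ES S) x₀).continuousLinearMapAt ℝ x v).1
        : EG) = v.1 ∧
        ((trivializationAt (EG × ES) (Ambient EG ES S) x₀).continuousLinearMapAt ℝ x v).2
        = e.continuousLinearMapAt ℝ x v.2 := by
      have hb : x ∈ (trivializationAt (EG × ES) (Ambient EG ES S) x₀).baseSet := ⟨mem_univ x, hx.1⟩
      rw [Trivialization.continuousLinearMapAt_apply, Trivialization.linearMapAt_apply, if_pos hb,
        Trivialization.continuousLinearMapAt_apply, Trivialization.linearMapAt_apply, if_pos hxe]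
      exact ⟨rfl, rfl⟩
    rw [hT, hv1.1, hv1.2, e.symmL_continuousLinearMapAt hxe]
    rw [sub_eq_zero]
    have hinv := isInvertible_mfderiv_extChartAt (I := 𝓘(ℝ, EM)) (x := f x₀) (y := f x)
      (by rw [extChartAt_source]; exact hx.2)
    constructor
    · intro h
      exact congrArg (mvfderiv 𝓘(ℝ, EM) ψ (f x)) h
    · intro h
      exact hinv.injective h

end Bundle

end Pullback

section PairCalculus

set_option linter.unusedSectionVars false

variable {ES : Type*} [NormedAddCommGroup ES] [NormedSpace ℝ ES]
  {S : Type*} [TopologicalSpace S] [ChartedSpace ES S] [IsManifold 𝓘(ℝ, ES) ∞ S]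
  {F : Type*} [NormedAddCommGroup F] [NormedSpace ℝ F]

theorem contMDiff_mvfderiv_apply {h : S → F} {v : ∀ x : S, TangentSpace 𝓘(ℝ, ES) x}
    (hh : ContMDiff 𝓘(ℝ, ES) 𝓘(ℝ, F) ∞ h)
    (hv : ContMDiff 𝓘(ℝ, ES) (𝓘(ℝ, ES).prod 𝓘(ℝ, ES)) ∞
      (fun x => (⟨x, v x⟩ : TangentBundle 𝓘(ℝ, ES) S))) :
    ContMDiff 𝓘(ℝ, ES) 𝓘(ℝ, F) ∞ (fun x => mvfderiv 𝓘(ℝ, ES) h x (v x)) := by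
  intro x
  have h1 := ((hh.contMDiff_tangentMap (m := ∞) (by simp)).comp hv) x
  have h2 := contMDiffAt_coord (IN := 𝓘(ℝ, ES)) (f := h)
    (v := fun x => mfderiv 𝓘(ℝ, ES) 𝓘(ℝ, F) h x (v x)) (h x)
    (by simp) h1
  refine h2.congr_of_eventuallyEq (Eventually.of_forall fun y => ?_)
  show _ = mvfderiv 𝓘(ℝ, F) (extChartAt 𝓘(ℝ, F) (h x)) (h y) (mfderiv 𝓘(ℝ, ES) 𝓘(ℝ, F) h y (v y))
  rw [extChartAt_model_space_eq_id]
  exact ((mvfderiv_vectorSpace _ _ _).trans (congrArg (fun L : F →L[ℝ] F =>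
    L (mfderiv 𝓘(ℝ, ES) 𝓘(ℝ, F) h y (v y))) fderiv_id)).symm

theorem contMDiff_mlieBracket [CompleteSpace ES] {v w : ∀ x : S, TangentSpace 𝓘(ℝ, ES) x}
    (hv : ContMDiff 𝓘(ℝ, ES) (𝓘(ℝ, ES).prod 𝓘(ℝ, ES)) ∞
      (fun x => (⟨x, v x⟩ : TangentBundle 𝓘(ℝ, ES) S)))
    (hw : ContMDiff 𝓘(ℝ, ES) (𝓘(ℝ, ES).prod 𝓘(ℝ, ES)) ∞
      (fun x => (⟨x, w x⟩ : TangentBundle 𝓘(ℝ, ES) S))) :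
    ContMDiff 𝓘(ℝ, ES) (𝓘(ℝ, ES).prod 𝓘(ℝ, ES)) ∞
      (fun x => (⟨x, mlieBracket 𝓘(ℝ, ES) v w x⟩ : TangentBundle 𝓘(ℝ, ES) S)) := fun x =>
  have : IsManifold 𝓘(ℝ, ES) (((⊤ : ℕ∞) : WithTop ℕ∞) + 1) S := by simpa
  have : IsManifold 𝓘(ℝ, ES) (minSmoothness ℝ 2) S := by
    rw [minSmoothness_of_isRCLikeNormedField]; infer_instance
  ContMDiffAt.mlieBracket_vectorField (m := ⊤) (n := ⊤) (hv x) (hw x)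
    (by rw [minSmoothness_of_isRCLikeNormedField]; simp)

theorem mvfderiv_clm_comp {F' : Type*} [NormedAddCommGroup F'] [NormedSpace ℝ F'] (L : F →L[ℝ] F')
    {h : S → F} {x : S} (hh : MDifferentiableAt 𝓘(ℝ, ES) 𝓘(ℝ, F) h x)
    (v : TangentSpace 𝓘(ℝ, ES) x) :
    mvfderiv 𝓘(ℝ, ES) (fun y => L (h y)) x v = L (mvfderiv 𝓘(ℝ, ES) h x v) := by
  have := mvfderiv_comp_fun (g := L) x L.differentiableAt.mdifferentiableAt hh v
  exact this.trans ((mvfderiv_vectorSpace _ _ _).trans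
    (congrArg (fun K : F →L[ℝ] F' => K (mvfderiv 𝓘(ℝ, ES) h x v)) L.fderiv))

variable {EG : Type*} [NormedAddCommGroup EG] [NormedSpace ℝ EG] [FiniteDimensional ℝ EG]
  (G : Type*) [TopologicalSpace G] [ChartedSpace EG G] [Group G] [LieGroup 𝓘(ℝ, EG) ∞ G]

theorem contMDiff_bracketR {A B : S → EG} (hA : ContMDiff 𝓘(ℝ, ES) 𝓘(ℝ, EG) ∞ A)
    (hB : ContMDiff 𝓘(ℝ, ES) 𝓘(ℝ, EG) ∞ B) :
    ContMDiff 𝓘(ℝ, ES) 𝓘(ℝ, EG) ∞ (fun x => bracketR G (A x) (B x)) :=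
  ((contMDiff_const (c := bracketRL G)).clm_apply hA).clm_apply hB

theorem mvfderiv_bracketR {A B : S → EG} {x : S} (hA : MDifferentiableAt 𝓘(ℝ, ES) 𝓘(ℝ, EG) A x)
    (hB : MDifferentiableAt 𝓘(ℝ, ES) 𝓘(ℝ, EG) B x) (v : TangentSpace 𝓘(ℝ, ES) x) :
    mvfderiv 𝓘(ℝ, ES) (fun y => bracketR G (A y) (B y)) x v =
      bracketR G (mvfderiv 𝓘(ℝ, ES) A x v) (B x) + bracketR G (A x) (mvfderiv 𝓘(ℝ, ES) B x v) := by
  have h1 : MDifferentiableAt 𝓘(ℝ, ES) 𝓘(ℝ, EG →L[ℝ] EG) (fun y => bracketRL G (A y)) x :=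
    (mdifferentiableAt_const (c := bracketRL G)).clm_apply hA
  have e1 := mvfderiv_clm_apply_fun h1 hB v
  have e2 := mvfderiv_clm_comp ((bracketRL G).flip (B x)) hA v
  simp only [ContinuousLinearMap.flip_apply, bracketRL_apply] at e1 e2
  rw [e1, e2]

/-- The `𝔤`-component of the bracket on sections of `(𝔤 × S) ⊕ TS`:
`v · B - w · A + {A, B}`. -/
noncomputable def pairBracket (A : S → EG) (v : ∀ x : S, TangentSpace 𝓘(ℝ, ES) x) (B : S → EG)
    (w : ∀ x : S, TangentSpace 𝓘(ℝ, ES) x) (x : S) : EG :=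
  mvfderiv 𝓘(ℝ, ES) B x (v x) - mvfderiv 𝓘(ℝ, ES) A x (w x) + bracketR G (A x) (B x)

theorem contMDiff_pairBracket {A B : S → EG} {v w : ∀ x : S, TangentSpace 𝓘(ℝ, ES) x}
    (hA : ContMDiff 𝓘(ℝ, ES) 𝓘(ℝ, EG) ∞ A)
    (hv : ContMDiff 𝓘(ℝ, ES) (𝓘(ℝ, ES).prod 𝓘(ℝ, ES)) ∞
      (fun x => (⟨x, v x⟩ : TangentBundle 𝓘(ℝ, ES) S)))
    (hB : ContMDiff 𝓘(ℝ, ES) 𝓘(ℝ, EG) ∞ B)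
    (hw : ContMDiff 𝓘(ℝ, ES) (𝓘(ℝ, ES).prod 𝓘(ℝ, ES)) ∞
      (fun x => (⟨x, w x⟩ : TangentBundle 𝓘(ℝ, ES) S))) :
    ContMDiff 𝓘(ℝ, ES) 𝓘(ℝ, EG) ∞ (pairBracket G A v B w) :=
  ((contMDiff_mvfderiv_apply hB hv).sub (contMDiff_mvfderiv_apply hA hw)).add
    (contMDiff_bracketR G hA hB)

theorem mvfderiv_pairBracket {A B : S → EG} {v w : ∀ x : S, TangentSpace 𝓘(ℝ, ES) x}
    (hA : ContMDiff 𝓘(ℝ, ES) 𝓘(ℝ, EG) ∞ A)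
    (hv : ContMDiff 𝓘(ℝ, ES) (𝓘(ℝ, ES).prod 𝓘(ℝ, ES)) ∞
      (fun x => (⟨x, v x⟩ : TangentBundle 𝓘(ℝ, ES) S)))
    (hB : ContMDiff 𝓘(ℝ, ES) 𝓘(ℝ, EG) ∞ B)
    (hw : ContMDiff 𝓘(ℝ, ES) (𝓘(ℝ, ES).prod 𝓘(ℝ, ES)) ∞
      (fun x => (⟨x, w x⟩ : TangentBundle 𝓘(ℝ, ES) S))) (x : S) (u : TangentSpace 𝓘(ℝ, ES) x) :
    mvfderiv 𝓘(ℝ, ES) (pairBracket G A v B w) x u =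
      mvfderiv 𝓘(ℝ, ES) (fun y => mvfderiv 𝓘(ℝ, ES) B y (v y)) x u -
      mvfderiv 𝓘(ℝ, ES) (fun y => mvfderiv 𝓘(ℝ, ES) A y (w y)) x u +
      (bracketR G (mvfderiv 𝓘(ℝ, ES) A x u) (B x) +
        bracketR G (A x) (mvfderiv 𝓘(ℝ, ES) B x u)) := by
  have d1 := (contMDiff_mvfderiv_apply hB hv).mdifferentiableAt (x := x) (by simp)
  have d2 := (contMDiff_mvfderiv_apply hA hw).mdifferentiableAt (x := x) (by simp)
  have d3 := (contMDiff_bracketR G hA hB).mdifferentiableAt (x := x) (by simp)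
  have e1 := congrArg (fun L => L u) (mvfderiv_add (d1.sub d2) d3)
  have e2 := congrArg (fun L => L u) (mvfderiv_sub d1 d2)
  refine e1.trans (congrArg₂ (· + ·) e2 ?_)
  exact mvfderiv_bracketR G (hA.mdifferentiableAt (by simp)) (hB.mdifferentiableAt (by simp)) u

theorem pairBracket_jacobi [CompleteSpace ES] {A B C : S → EG}
    {a b c : ∀ x : S, TangentSpace 𝓘(ℝ, ES) x}
    (hA : ContMDiff 𝓘(ℝ, ES) 𝓘(ℝ, EG) ∞ A)
    (ha : ContMDiff 𝓘(ℝ, ES) (𝓘(ℝ, ES).prod 𝓘(ℝ, ES)) ∞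
      (fun x => (⟨x, a x⟩ : TangentBundle 𝓘(ℝ, ES) S)))
    (hB : ContMDiff 𝓘(ℝ, ES) 𝓘(ℝ, EG) ∞ B)
    (hb : ContMDiff 𝓘(ℝ, ES) (𝓘(ℝ, ES).prod 𝓘(ℝ, ES)) ∞
      (fun x => (⟨x, b x⟩ : TangentBundle 𝓘(ℝ, ES) S)))
    (hC : ContMDiff 𝓘(ℝ, ES) 𝓘(ℝ, EG) ∞ C)
    (hc : ContMDiff 𝓘(ℝ, ES) (𝓘(ℝ, ES).prod 𝓘(ℝ, ES)) ∞
      (fun x => (⟨x, c x⟩ : TangentBundle 𝓘(ℝ, ES) S))) (x : S) :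
    pairBracket G A a (pairBracket G B b C c) (mlieBracket 𝓘(ℝ, ES) b c) x =
      pairBracket G (pairBracket G A a B b) (mlieBracket 𝓘(ℝ, ES) a b) C c x +
      pairBracket G B b (pairBracket G A a C c) (mlieBracket 𝓘(ℝ, ES) a c) x := by
  have d : ∀ {v : ∀ x : S, TangentSpace 𝓘(ℝ, ES) x}, ContMDiff 𝓘(ℝ, ES) (𝓘(ℝ, ES).prod 𝓘(ℝ, ES)) ∞
      (fun x => (⟨x, v x⟩ : TangentBundle 𝓘(ℝ, ES) S)) →
      MDifferentiableAt 𝓘(ℝ, ES) (𝓘(ℝ, ES).prod 𝓘(ℝ, ES))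
      (fun x => (⟨x, v x⟩ : TangentBundle 𝓘(ℝ, ES) S)) x :=
    fun h => h.mdifferentiableAt (by simp)
  have j := bracketR_jacobi G (A x) (B x) (C x)
  have s : ∀ ξ η ζ : EG, bracketR G (ξ + η) ζ = bracketR G ξ ζ + bracketR G η ζ :=
    bracketR_add_left G
  have s' : ∀ ξ η ζ : EG, bracketR G (ξ - η) ζ = bracketR G ξ ζ - bracketR G η ζ := fun ξ η ζ =>
    congrArg (fun L : EG →L[ℝ] EG => L ζ) (map_sub (bracketRL G) ξ η)
  have t : ∀ ξ η ζ : EG, bracketR G ξ (η + ζ) = bracketR G ξ η + bracketR G ξ ζ := fun ξ η ζ =>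
    map_add (bracketRL G ξ) η ζ
  have t' : ∀ ξ η ζ : EG, bracketR G ξ (η - ζ) = bracketR G ξ η - bracketR G ξ ζ := fun ξ η ζ =>
    map_sub (bracketRL G ξ) η ζ
  have u1 : pairBracket G A a (pairBracket G B b C c) (mlieBracket 𝓘(ℝ, ES) b c) x =
    mvfderiv 𝓘(ℝ, ES) (pairBracket G B b C c) x (a x) -
      mvfderiv 𝓘(ℝ, ES) A x (mlieBracket 𝓘(ℝ, ES) b c x) +
      bracketR G (A x) (mvfderiv 𝓘(ℝ, ES) C x (b x) - mvfderiv 𝓘(ℝ, ES) B x (c x) +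
        bracketR G (B x) (C x)) := rfl
  have u2 : pairBracket G (pairBracket G A a B b) (mlieBracket 𝓘(ℝ, ES) a b) C c x =
    mvfderiv 𝓘(ℝ, ES) C x (mlieBracket 𝓘(ℝ, ES) a b x) -
      mvfderiv 𝓘(ℝ, ES) (pairBracket G A a B b) x (c x) +
      bracketR G (mvfderiv 𝓘(ℝ, ES) B x (a x) - mvfderiv 𝓘(ℝ, ES) A x (b x) +
        bracketR G (A x) (B x)) (C x) := rfl
  have u3 : pairBracket G B b (pairBracket G A a C c) (mlieBracket 𝓘(ℝ, ES) a c) x =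
    mvfderiv 𝓘(ℝ, ES) (pairBracket G A a C c) x (b x) -
      mvfderiv 𝓘(ℝ, ES) B x (mlieBracket 𝓘(ℝ, ES) a c x) +
      bracketR G (B x) (mvfderiv 𝓘(ℝ, ES) C x (a x) - mvfderiv 𝓘(ℝ, ES) A x (c x) +
        bracketR G (A x) (C x)) := rfl
  rw [u1, u2, u3, mvfderiv_pairBracket G hB hb hC hc, mvfderiv_pairBracket G hA ha hB hb,
    mvfderiv_pairBracket G hA ha hC hc, mvfderiv_mlieBracket (d hb) (d hc) (hA x),
    mvfderiv_mlieBracket (d ha) (d hb) (hC x), mvfderiv_mlieBracket (d ha) (d hc) (hB x)]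
  simp only [s, s', t, t', j]
  rw [bracketR_swap G (mvfderiv 𝓘(ℝ, ES) A x (b x)) (C x)] 
  rw [bracketR_swap G (B x) (mvfderiv 𝓘(ℝ, ES) A x (c x))] 
  abel

end PairCalculus

section LogDeriv

set_option linter.unusedSectionVars false

variable {EG : Type*} [NormedAddCommGroup EG] [NormedSpace ℝ EG] [FiniteDimensional ℝ EG]
  (G : Type*) [TopologicalSpace G] [ChartedSpace EG G] [Group G] [LieGroup 𝓘(ℝ, EG) ∞ G]
  [SecondCountableTopology G]
  {EM : Type*} [NormedAddCommGroup EM] [NormedSpace ℝ EM] [FiniteDimensional ℝ EM]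
  {M : Type*} [TopologicalSpace M] [ChartedSpace EM M] [IsManifold 𝓘(ℝ, EM) ∞ M] [T2Space M]
  [MulAction G M] [ContMDiffSMul 𝓘(ℝ, EG) 𝓘(ℝ, EM) ∞ G M] [MulAction.IsPretransitive G M]
  {ES : Type*} [NormedAddCommGroup ES] [NormedSpace ℝ ES] [FiniteDimensional ℝ ES]
  {S : Type*} [TopologicalSpace S] [ChartedSpace ES S] [IsManifold 𝓘(ℝ, ES) ∞ S]
  (f : C^∞⟮𝓘(ℝ, ES), S; 𝓘(ℝ, EM), M⟯)

variable (EG) in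
/-- The fibres of `A(f)`. -/
abbrev PFib (x : S) : Type _ := pullbackFiber (EG := EG) (EM := EM) (ES := ES) G f x

variable (EG EM ES) in
/-- The model fibre of `A(f)`. -/
abbrev PModel : Type := EuclideanSpace ℝ (Fin (pullbackRank EG EM ES))

noncomputable def pullbackChart (x₀ : S) :
    KernelBundle.Chart (EB := ES) (EG × ES) EM (PModel EG EM ES)
      (pullbackFiber (EG := EG) (EM := EM) (ES := ES) G f) x₀ :=
  Classical.choice (exists_chart G f.contMDiff x₀)

/-- `A(f)` is a smooth vector bundle, as a subbundle of `(𝔤 × S) ⊕ TS`; a map into it is smooth iff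
its two components are (`contMDiff_pullback_iff`). -/
noncomputable instance pullbackTop : TopologicalSpace (TotalSpace (PModel EG EM ES) (PFib EG G f)) :=
  (KernelBundle.prebundle (pullbackChart (EG := EG) G f)).totalSpaceTopology

noncomputable instance pullbackFiberBundle : FiberBundle (PModel EG EM ES) (PFib EG G f) :=
  (KernelBundle.prebundle (pullbackChart (EG := EG) G f)).toFiberBundle

instance pullbackVectorBundle : VectorBundle ℝ (PModel EG EM ES) (PFib EG G f) :=
  (KernelBundle.prebundle (pullbackChart (EG := EG) G f)).toVectorBundle

instance pullbackSmoothBundle :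
    ContMDiffVectorBundle ∞ (PModel EG EM ES) (PFib EG G f) 𝓘(ℝ, ES) :=
  haveI := KernelBundle.prebundle_isContMDiff (pullbackChart (EG := EG) G f)
  (KernelBundle.prebundle (pullbackChart (EG := EG) G f)).contMDiffVectorBundle 𝓘(ℝ, ES)

theorem contMDiff_pullback_iff {EN : Type*} [NormedAddCommGroup EN] [NormedSpace ℝ EN]
    {HN : Type*} [TopologicalSpace HN] {IN : ModelWithCorners ℝ EN HN} {N : Type*}
    [TopologicalSpace N] [ChartedSpace HN N]
    (g : N → TotalSpace (PModel EG EM ES) (PFib EG G f)) :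
    ContMDiff IN (𝓘(ℝ, ES).prod 𝓘(ℝ, PModel EG EM ES)) ∞ g ↔
      ContMDiff IN 𝓘(ℝ, EG) ∞ (fun n => ((g n).2.1.1 : EG)) ∧
      ContMDiff IN (𝓘(ℝ, ES).prod 𝓘(ℝ, ES)) ∞
        (fun n => (⟨(g n).1, (g n).2.1.2⟩ : TangentBundle 𝓘(ℝ, ES) S)) :=
  (KernelBundle.contMDiff_iff (pullbackChart (EG := EG) G f) g).trans contMDiff_ambient_iff

/-- The natural map `A(f) → 𝔤`. -/
noncomputable def gPart (x : S) : PFib EG G f x →ₗ[ℝ] EG :=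
  LinearMap.fst ℝ EG (TangentSpace 𝓘(ℝ, ES) x) ∘ₗ (pullbackFiber (EG := EG) (EM := EM) (ES := ES) G f x).subtype

/-- The natural map `A(f) → TS`. -/
noncomputable def tPart (x : S) : PFib EG G f x →ₗ[ℝ] TangentSpace 𝓘(ℝ, ES) x :=
  LinearMap.snd ℝ EG (TangentSpace 𝓘(ℝ, ES) x) ∘ₗ (pullbackFiber (EG := EG) (EM := EM) (ES := ES) G f x).subtype

variable {G f}

theorem pfib_ext {x : S} {p q : PFib EG G f x} (h1 : gPart G f x p = gPart G f x q)
    (h2 : tPart G f x p = tPart G f x q) : p = q := Subtype.ext (Prod.ext h1 h2)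

theorem infGen_gPart (x : S) (p : PFib EG G f x) :
    infGen EG G EM (f x) (gPart G f x p) = mfderiv 𝓘(ℝ, ES) 𝓘(ℝ, EM) f x (tPart G f x p) := p.2

theorem contMDiff_gPart (X : Cₛ^∞⟮𝓘(ℝ, ES); PModel EG EM ES, PFib EG G f⟯) :
    ContMDiff 𝓘(ℝ, ES) 𝓘(ℝ, EG) ∞ (fun x => gPart G f x (X x)) :=
  ((contMDiff_pullback_iff G f _).1 X.contMDiff).1

theorem contMDiff_tPart (X : Cₛ^∞⟮𝓘(ℝ, ES); PModel EG EM ES, PFib EG G f⟯) :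
    ContMDiff 𝓘(ℝ, ES) (𝓘(ℝ, ES).prod 𝓘(ℝ, ES)) ∞
      (fun x => (⟨x, tPart G f x (X x)⟩ : TangentBundle 𝓘(ℝ, ES) S)) :=
  ((contMDiff_pullback_iff G f _).1 X.contMDiff).2

/-- The bracket of sections of `A(f)`:
`[(A, v), (B, w)] = (v · B - w · A + {A, B}, [v, w])`. -/
noncomputable def pullbackBracket (X Y : Cₛ^∞⟮𝓘(ℝ, ES); PModel EG EM ES, PFib EG G f⟯) :
    Cₛ^∞⟮𝓘(ℝ, ES); PModel EG EM ES, PFib EG G f⟯ where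
  toFun x :=
    ⟨(pairBracket G (fun y => gPart G f y (X y)) (fun y => tPart G f y (X y))
        (fun y => gPart G f y (Y y)) (fun y => tPart G f y (Y y)) x,
      mlieBracket 𝓘(ℝ, ES) (fun y => tPart G f y (X y)) (fun y => tPart G f y (Y y)) x),
      haveI : CompleteSpace ES := FiniteDimensional.complete ℝ ES
      haveI : CompleteSpace EG := FiniteDimensional.complete ℝ EG
      haveI : CompleteSpace EM := FiniteDimensional.complete ℝ EM
      (mfderiv_mlieBracket G (f.contMDiff x) ((contMDiff_tPart X).mdifferentiableAt (by simp))
        ((contMDiff_tPart Y).mdifferentiableAt (by simp))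
        ((contMDiff_gPart X).mdifferentiableAt (by simp))
        ((contMDiff_gPart Y).mdifferentiableAt (by simp))
        (fun y => (infGen_gPart y (X y)).symm) (fun y => (infGen_gPart y (Y y)).symm)).symm⟩
  contMDiff_toFun := by
    have : CompleteSpace ES := FiniteDimensional.complete ℝ ES
    rw [contMDiff_pullback_iff]
    exact ⟨contMDiff_pairBracket G (contMDiff_gPart X) (contMDiff_tPart X) (contMDiff_gPart Y)
      (contMDiff_tPart Y), contMDiff_mlieBracket (contMDiff_tPart X) (contMDiff_tPart Y)⟩

theorem gPart_bracket (X Y : Cₛ^∞⟮𝓘(ℝ, ES); PModel EG EM ES, PFib EG G f⟯) (x : S) :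
    gPart G f x (pullbackBracket X Y x) =
      pairBracket G (fun y => gPart G f y (X y)) (fun y => tPart G f y (X y))
        (fun y => gPart G f y (Y y)) (fun y => tPart G f y (Y y)) x := rfl

theorem tPart_bracket (X Y : Cₛ^∞⟮𝓘(ℝ, ES); PModel EG EM ES, PFib EG G f⟯) (x : S) :
    tPart G f x (pullbackBracket X Y x) =
      mlieBracket 𝓘(ℝ, ES) (fun y => tPart G f y (X y)) (fun y => tPart G f y (Y y)) x := rfl

variable (G f) in
/-- The Lie algebroid `A(f)`, the pullback of the action algebroid `𝔤 × M` along `f`. -/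
noncomputable def pullbackAlgebroid : LieAlgebroid ES S where
  rank := pullbackRank EG EM ES
  Fib := PFib EG G f
  anchor := tPart G f
  anchor_smooth := ((contMDiff_pullback_iff G f _).1 contMDiff_id).2
  bracket := pullbackBracket
  bracket_add X Y Z := by
    refine ContMDiffSection.ext fun x => pfib_ext ?_ ?_
    · have h := congrArg (fun L => L (tPart G f x (X x))) (mvfderiv_add
        ((contMDiff_gPart Y).mdifferentiableAt (x := x) (by simp))
        ((contMDiff_gPart Z).mdifferentiableAt (x := x) (by simp)))
      have e1 : pairBracket G (fun y => gPart G f y (X y)) (fun y => tPart G f y (X y))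
          (fun y => gPart G f y (Y y) + gPart G f y (Z y))
          (fun y => tPart G f y (Y y) + tPart G f y (Z y)) x =
          pairBracket G (fun y => gPart G f y (X y)) (fun y => tPart G f y (X y))
          (fun y => gPart G f y (Y y)) (fun y => tPart G f y (Y y)) x +
          pairBracket G (fun y => gPart G f y (X y)) (fun y => tPart G f y (X y))
          (fun y => gPart G f y (Z y)) (fun y => tPart G f y (Z y)) x := by
        have h2 : bracketR G (gPart G f x (X x)) (gPart G f x (Y x) + gPart G f x (Z x)) =
          bracketR G (gPart G f x (X x)) (gPart G f x (Y x)) +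
          bracketR G (gPart G f x (X x)) (gPart G f x (Z x)) :=
          map_add (bracketRL G (gPart G f x (X x))) _ _
        have h3 := map_add (mvfderiv 𝓘(ℝ, ES) (fun y => gPart G f y (X y)) x)
          (tPart G f x (Y x)) (tPart G f x (Z x))
        refine (congrArg₂ (· + ·) (congrArg₂ (· - ·) h h3) h2).trans ?_
        simp only [pairBracket, add_apply]
        abel
      exact e1
    · exact mlieBracket_add_right (V := fun y => tPart G f y (X y))
        ((contMDiff_tPart Y).mdifferentiableAt (x := x) (by simp))
        ((contMDiff_tPart Z).mdifferentiableAt (x := x) (by simp))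
  bracket_const_smul c X Y := by
    refine ContMDiffSection.ext fun x => pfib_ext ?_ ?_
    · have e1 : pairBracket G (fun y => gPart G f y (X y)) (fun y => tPart G f y (X y))
          (fun y => c • gPart G f y (Y y)) (fun y => c • tPart G f y (Y y)) x =
          c • pairBracket G (fun y => gPart G f y (X y)) (fun y => tPart G f y (X y))
          (fun y => gPart G f y (Y y)) (fun y => tPart G f y (Y y)) x := by
        have h := mvfderiv_clm_comp (c • ContinuousLinearMap.id ℝ EG)
          ((contMDiff_gPart Y).mdifferentiableAt (x := x) (by simp)) (tPart G f x (X x))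
        have h2 : bracketR G (gPart G f x (X x)) (c • gPart G f x (Y x)) =
          c • bracketR G (gPart G f x (X x)) (gPart G f x (Y x)) :=
          map_smul (bracketRL G (gPart G f x (X x))) _ _
        have h3 := map_smul (mvfderiv 𝓘(ℝ, ES) (fun y => gPart G f y (X y)) x) c
          (tPart G f x (Y x))
        refine (congrArg₂ (· + ·) (congrArg₂ (· - ·) h h3) h2).trans ?_
        simp only [pairBracket, smul_add, smul_sub]
        rfl
      exact e1
    · exact mlieBracket_const_smul_right (V := fun y => tPart G f y (X y)) (c := c)
        ((contMDiff_tPart Y).mdifferentiableAt (x := x) (by simp))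
  bracket_swap X Y := by
    refine ContMDiffSection.ext fun x => pfib_ext ?_ mlieBracket_swap_apply
    have e1 : pairBracket G (fun y => gPart G f y (X y)) (fun y => tPart G f y (X y))
          (fun y => gPart G f y (Y y)) (fun y => tPart G f y (Y y)) x =
        -pairBracket G (fun y => gPart G f y (Y y)) (fun y => tPart G f y (Y y))
          (fun y => gPart G f y (X y)) (fun y => tPart G f y (X y)) x := by
      simp only [pairBracket]
      rw [bracketR_swap]
      abel
    exact e1
  jacobi X Y Z := by
    have : CompleteSpace ES := FiniteDimensional.complete ℝ ES
    have : IsManifold 𝓘(ℝ, ES) (minSmoothness ℝ 3) S := by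
      rw [minSmoothness_of_isRCLikeNormedField]
      exact IsManifold.of_le (n := ∞) (WithTop.coe_le_coe.2 (le_top : (3 : ℕ∞) ≤ ⊤))
    have hs : ∀ X : Cₛ^∞⟮𝓘(ℝ, ES); PModel EG EM ES, PFib EG G f⟯, ∀ x,
        ContMDiffAt 𝓘(ℝ, ES) (𝓘(ℝ, ES).prod 𝓘(ℝ, ES)) (minSmoothness ℝ 2)
        (fun x => (⟨x, tPart G f x (X x)⟩ : TangentBundle 𝓘(ℝ, ES) S)) x := fun X x =>
      ((contMDiff_tPart X) x).of_le
        (by rw [minSmoothness_of_isRCLikeNormedField]; exact ENat.LEInfty.out)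
    refine ContMDiffSection.ext fun x => pfib_ext ?_ ?_
    · exact pairBracket_jacobi G (contMDiff_gPart X) (contMDiff_tPart X) (contMDiff_gPart Y)
        (contMDiff_tPart Y) (contMDiff_gPart Z) (contMDiff_tPart Z) x
    · exact leibniz_identity_mlieBracket_apply (hs X x) (hs Y x) (hs Z x)
  leibniz X Y Y' g hg hY x := by
    have hB : (fun y => gPart G f y (Y' y)) = g • fun y => gPart G f y (Y y) := by
      ext y; rw [hY, map_smul]; rfl
    have hb : (fun y => tPart G f y (Y' y)) = g • fun y => tPart G f y (Y y) := by
      funext y; rw [hY, map_smul]; rfl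
    have hgd := hg.mdifferentiableAt (x := x) (by simp)
    refine pfib_ext ?_ ?_
    · have h := congrArg (fun L => L (tPart G f x (X x))) (mvfderiv_smul hgd
        ((contMDiff_gPart Y).mdifferentiableAt (x := x) (by simp)))
      have h2 : bracketR G (gPart G f x (X x)) (g x • gPart G f x (Y x)) =
        g x • bracketR G (gPart G f x (X x)) (gPart G f x (Y x)) :=
        map_smul (bracketRL G (gPart G f x (X x))) _ _
      have h3 := map_smul (mvfderiv 𝓘(ℝ, ES) (fun y => gPart G f y (X y)) x) (g x)
        (tPart G f x (Y x))
      have e1 : pairBracket G (fun y => gPart G f y (X y)) (fun y => tPart G f y (X y))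
          (g • fun y => gPart G f y (Y y)) (g • fun y => tPart G f y (Y y)) x =
          g x • pairBracket G (fun y => gPart G f y (X y)) (fun y => tPart G f y (X y))
            (fun y => gPart G f y (Y y)) (fun y => tPart G f y (Y y)) x +
          mvfderiv 𝓘(ℝ, ES) g x (tPart G f x (X x)) • gPart G f x (Y x) := by
        refine (congrArg₂ (· + ·) (congrArg₂ (· - ·) h h3) h2).trans ?_
        simp only [pairBracket, smul_add, smul_sub, add_apply, smul_apply,
          ContinuousLinearMap.smulRight_apply]
        abel
      rw [gPart_bracket, hB, hb, e1, map_add, map_smul, map_smul, gPart_bracket]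
    · rw [tPart_bracket, hb, mlieBracket_smul_right hgd
        ((contMDiff_tPart Y).mdifferentiableAt (x := x) (by simp)), map_add, map_smul, map_smul,
        tPart_bracket, add_comm]
  anchor_bracket X Y x := rfl

variable (EG G f) in
/-- The logarithmic derivative `δf : A(f) → 𝔤`, `(ξ, v) ↦ ξ`, of `f : S → M`. -/
noncomputable def logarithmicDerivative [Nonempty S] : MCForm EG G EM M ES S where
  alg := pullbackAlgebroid G f
  form := gPart G f
  form_smooth := ((contMDiff_pullback_iff G f _).1 contMDiff_id).1
  form_bracket X Y x := rfl
  transitive x v := by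
    obtain ⟨ξ, hξ⟩ := infGen_surjective (EG := EG) G (f x) (mfderiv 𝓘(ℝ, ES) 𝓘(ℝ, EM) f x v)
    exact ⟨⟨(ξ, v), hξ⟩, rfl⟩
  injective x a b ha hb hab := pfib_ext hab (ha.trans hb.symm)
  exists_stabilizer := by
    obtain ⟨x₀⟩ := ‹Nonempty S›
    refine ⟨x₀, f x₀, fun a ha => ?_⟩
    refine (infGen_gPart x₀ a).trans ?_
    exact (congrArg (mfderiv 𝓘(ℝ, ES) 𝓘(ℝ, EM) f x₀) ha).trans (map_zero _)

end LogDeriv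

section Symmetry

variable {EG : Type*} [NormedAddCommGroup EG] [NormedSpace ℝ EG] [FiniteDimensional ℝ EG]
  (G : Type*) [TopologicalSpace G] [ChartedSpace EG G] [Group G] [LieGroup 𝓘(ℝ, EG) ∞ G]
  [SecondCountableTopology G]
  {EM : Type*} [NormedAddCommGroup EM] [NormedSpace ℝ EM] [FiniteDimensional ℝ EM]
  {M : Type*} [TopologicalSpace M] [ChartedSpace EM M] [IsManifold 𝓘(ℝ, EM) ∞ M] [T2Space M]
  [MulAction G M] [ContMDiffSMul 𝓘(ℝ, EG) 𝓘(ℝ, EM) ∞ G M] [MulAction.IsPretransitive G M]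
  {ES : Type*} [NormedAddCommGroup ES] [NormedSpace ℝ ES] [FiniteDimensional ℝ ES]
  {S : Type*} [TopologicalSpace S] [ChartedSpace ES S] [IsManifold 𝓘(ℝ, ES) ∞ S]
  [Nonempty S]

variable {G} in
/-- The diffeomorphism `φ` of `M` satisfies `φ(g • m) = l g l⁻¹ • φ(m)` for all `g`, `m`. -/
def IsSymmetryBy (l : G) (φ : M ≃ₘ⟮𝓘(ℝ, EM), 𝓘(ℝ, EM)⟯ M) : Prop :=
  ∀ (g : G) (m : M), φ (g • m) = (l * g * l⁻¹) • φ m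

/-- The symmetries of `M`, i.e. the elements of `Aut(M)`. -/
def IsSymmetry (φ : M ≃ₘ⟮𝓘(ℝ, EM), 𝓘(ℝ, EM)⟯ M) : Prop :=
  ∃ l : G, IsSymmetryBy l φ

variable (EG) in
/-- The natural map `A(f) → 𝔤 × M`, sending `(ξ, v)` in the fibre over `x` to `(ξ, f x)`. -/
noncomputable def toAction (f : C^∞⟮𝓘(ℝ, ES), S; 𝓘(ℝ, EM), M⟯) (x : S)
    (a : (logarithmicDerivative EG G f).alg.Fib x) : EG × M :=
  (gPart G f x a, f x)

end Symmetry

/-! ### Conjugation-equivariant maps, infinitesimal generators and the adjoint action -/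

section Equivariance

variable {EG : Type*} [NormedAddCommGroup EG] [NormedSpace ℝ EG]
  {G : Type*} [TopologicalSpace G] [ChartedSpace EG G] [Group G]
  {EM : Type*} [NormedAddCommGroup EM] [NormedSpace ℝ EM]
  {M : Type*} [TopologicalSpace M] [ChartedSpace EM M]
  [MulAction G M] [ContMDiffSMul 𝓘(ℝ, EG) 𝓘(ℝ, EM) ∞ G M]

/-! The isomorphism is the map `(ξ, v) ↦ (Ad l ξ, v)`: the symmetry acts on the Lie algebra through
`Ad l`, moves the base point in `M` through `φ`, and leaves the tangent vectors of the source
manifold alone. Everything reduces to one infinitesimal fact. Differentiating `φ (g • m) = (l * g *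
l⁻¹) • φ m` in `g` at the identity gives `Tφ (ξ†(m)) = (Ad l ξ)†(φ m)`, which is
`mfderiv_infGen_of_conj_equivariant`. If `(ξ, v)` lies in the fibre of `A(f₁)` over `x`, so that
`ξ†(f₁ x) = Tf₁ v`, applying `Tφ` to this equation yields `(Ad l ξ)†(f₂ x) = Tf₂ v`, the equation of
the fibre of `A(f₂)`. This is `IsSymmetryBy.pullback_compat`.

The anchors agree because the tangent component is untouched, and the square with `Ad l` commutes by
construction. Compatibility with brackets concerns only the Lie algebra component `v · Y - w · X +
{X, Y}`. The operator `Ad l` is a fixed linear map, so it passes through the two derivative terms,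
and it passes through the pointwise term because it is a Lie algebra automorphism (`bracketR_Ad`).
The automorphism property is the same infinitesimal fact once more: conjugation by `l` is
equivariant for the action of `G` on itself by left translations, whose generators are the
right-invariant fields, so it carries the field of `ξ` to the field of `Ad l ξ`. Related fields have
related brackets, and evaluation at the identity finishes the argument.

The inverse needs no separate computation. The diffeomorphism `φ.symm` is a symmetry with group
element `l⁻¹` (`IsSymmetryBy.symm`) and carries `f₂` back to `f₁`, so the same construction gives a
morphism in the other direction. The two composites are the identity because `Ad` is multiplicative.
-/

theorem contMDiff_orbit (m : M) : ContMDiff 𝓘(ℝ, EG) 𝓘(ℝ, EM) ∞ (fun g : G => g • m) :=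
  (contMDiff_smul (I := 𝓘(ℝ, EG)) (I' := 𝓘(ℝ, EM)) (n := ∞) (G := G) (M := M)).comp
    (contMDiff_id.prodMk contMDiff_const)

variable [LieGroup 𝓘(ℝ, EG) ∞ G]

theorem contMDiff_conj (l : G) :
    ContMDiff 𝓘(ℝ, EG) 𝓘(ℝ, EG) ∞ (fun g : G => l * g * l⁻¹) :=
  (contMDiff_const.mul contMDiff_id).mul contMDiff_const

/-- A map that is equivariant along conjugation by `l` sends `ξ†` to `(Ad_l ξ)†`. -/
theorem mfderiv_infGen_of_conj_equivariant {l : G} {φ : M → M}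
    (hs : ContMDiff 𝓘(ℝ, EM) 𝓘(ℝ, EM) ∞ φ)
    (hφ : ∀ (g : G) (m : M), φ (g • m) = (l * g * l⁻¹) • φ m) (m : M) (ξ : EG) :
    mfderiv 𝓘(ℝ, EM) 𝓘(ℝ, EM) φ m (infGen EG G EM m ξ) = infGen EG G EM (φ m) (Ad l ξ) := by
  -- The same map `G → M` is differentiated at the identity in two ways: here as `φ` after the orbit
  -- map of `m`, and in `h2` as the orbit map of `φ m` after conjugation by `l`. In `h2` the
  -- derivative of the inner map at the identity is `Ad l` by definition.
  have h1 := mfderiv_comp_apply (I := 𝓘(ℝ, EG)) (I' := 𝓘(ℝ, EM)) (I'' := 𝓘(ℝ, EM)) (1 : G)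
    (hs.mdifferentiableAt (x := (1 : G) • m) (by simp))
    ((contMDiff_orbit (EG := EG) (EM := EM) m).mdifferentiableAt (x := (1 : G)) (by simp)) ξ
  have h2 := mfderiv_comp_apply (I := 𝓘(ℝ, EG)) (I' := 𝓘(ℝ, EG)) (I'' := 𝓘(ℝ, EM)) (1 : G)
    ((contMDiff_orbit (EG := EG) (EM := EM) (φ m)).mdifferentiableAt
      (x := l * 1 * l⁻¹) (by simp))
    ((contMDiff_conj (EG := EG) l).mdifferentiableAt (x := (1 : G)) (by simp)) ξ
  -- Equivariance, read as an equality of maps `G → M` for fixed `m`, is what identifies the two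
  -- composites.
  have e : (φ ∘ fun g : G => g • m) = (fun g : G => g • φ m) ∘ fun g : G => l * g * l⁻¹ :=
    funext fun g => hφ g m
  -- The chain rule produces derivatives at `1 • m` and `l * 1 * l⁻¹`, which equal `m` and `1` only
  -- propositionally. All tangent spaces here unfold to the model space, so the values are compared
  -- in `EM`; generalizing the base point to a variable then lets the equation be substituted away.
  have c1 : ∀ m' : M, m' = m → ∀ u : EM, (mfderiv 𝓘(ℝ, EM) 𝓘(ℝ, EM) φ m' u : EM) =
      (mfderiv 𝓘(ℝ, EM) 𝓘(ℝ, EM) φ m u : EM) := by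
    rintro _ rfl u; rfl
  have c2 : ∀ g : G, g = 1 → ∀ u : EG,
      (mfderiv 𝓘(ℝ, EG) 𝓘(ℝ, EM) (fun g : G => g • φ m) g u : EM) =
        infGen EG G EM (φ m) u := by
    rintro _ rfl u; rfl
  -- The ascription to `EM` makes the value independent of the map in its type, so that `e` can be
  -- applied by congruence where a rewrite would meet a dependent tangent space.
  have h3 : (mfderiv 𝓘(ℝ, EG) 𝓘(ℝ, EM) (φ ∘ fun g : G => g • m) 1 ξ : EM) =
      mfderiv 𝓘(ℝ, EG) 𝓘(ℝ, EM) ((fun g : G => g • φ m) ∘ fun g : G => l * g * l⁻¹) 1 ξ :=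
    congrArg (fun p : G → M => (mfderiv 𝓘(ℝ, EG) 𝓘(ℝ, EM) p 1 ξ : EM)) e
  exact (c1 _ (one_smul G m) _).symm.trans
    (h1.symm.trans (h3.trans (h2.trans (c2 _ (by group) _))))

variable [FiniteDimensional ℝ EG]

/-- `Ad_l` is an automorphism of the Lie algebra `𝔤`. -/
theorem bracketR_Ad (l : G) (ξ η : EG) :
    bracketR G (Ad l ξ) (Ad l η) = Ad l (bracketR G ξ η) := by
  have : CompleteSpace EG := FiniteDimensional.complete ℝ EG
  have : IsManifold 𝓘(ℝ, EG) ∞ G := inferInstance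
  have : IsManifold 𝓘(ℝ, EG) 1 G := inferInstance
  -- The preceding theorem is used with `M = G` under left translation, where equivariance is the
  -- identity `l (g h) l⁻¹ = (l g l⁻¹)(l h l⁻¹)`. The generators for this action are the
  -- right-invariant fields, so conjugation relates the field of `ζ` to that of `Ad l ζ` at every
  -- point of `G`.
  have hc : ∀ (ζ : EG) (g : G), mfderiv 𝓘(ℝ, EG) 𝓘(ℝ, EG) (fun g : G => l * g * l⁻¹) g
      (infGen EG G EG g ζ) = infGen EG G EG (l * g * l⁻¹) (Ad l ζ) := fun ζ g =>
    mfderiv_infGen_of_conj_equivariant (EG := EG) (contMDiff_conj l)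
      (fun g h => by simp [mul_assoc]) g ζ
  -- This compatibility is the one that makes sections of `A(f)` closed under the bracket, applied
  -- to `f` equal to conjugation. The coefficient functions are the constants `Ad l ξ` and `Ad l η`,
  -- so both derivative terms vanish and only the pointwise bracket is left on the right.
  have h := mfderiv_mlieBracket (EM := EG) (f := fun g : G => l * g * l⁻¹) (n₀ := (1 : G))
    (v := fundField G EG ξ) (w := fundField G EG η) (X := fun _ => Ad l ξ) (Y := fun _ => Ad l η)
    G (contMDiff_conj l).contMDiffAt
    (mdifferentiableAt_fundField (EM := EG) G ξ 1) (mdifferentiableAt_fundField (EM := EG) G η 1)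
    mdifferentiableAt_const mdifferentiableAt_const (hc ξ) (hc η)
  rw [mvfderiv_const, mvfderiv_const] at h
  -- The equation obtained lives at `l * 1 * l⁻¹`. Once this point is identified with `1`, a
  -- right-invariant field returns the Lie algebra element that defines it.
  have c : ∀ g : G, g = 1 → ∀ u : EG, (infGen EG G EG g u : EG) = u := by
    rintro _ rfl u; exact infGen_one_right G u
  -- The left side of `h` is already this one by unfolding: `bracketR` is the bracket of the
  -- right-invariant fields at `1`, and `Ad l` is the derivative of conjugation there.
  have h' : (Ad l (bracketR G ξ η) : EG) = _ := h.trans (c _ (by group) _)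
  rw [h']
  simp

end Equivariance

/-! ### The inverse of a symmetry -/

/-- Conjugation by `l⁻¹` undoes conjugation by `l`, so applying the injective map `φ` to both sides
reduces the claim to `l (l⁻¹ g l) l⁻¹ = g`. This supplies the inverse of the isomorphism of
logarithmic derivatives. -/
theorem IsSymmetryBy.symm {G : Type*} [Group G]
    {EM : Type*} [NormedAddCommGroup EM] [NormedSpace ℝ EM]
    {M : Type*} [TopologicalSpace M] [ChartedSpace EM M] [MulAction G M]
    {l : G} {φ : M ≃ₘ⟮𝓘(ℝ, EM), 𝓘(ℝ, EM)⟯ M} (h : IsSymmetryBy l φ) : IsSymmetryBy l⁻¹ φ.symm := by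
  intro g m
  apply φ.injective
  refine (φ.apply_symm_apply _).trans ((h _ _).trans ?_).symm
  rw [φ.apply_symm_apply]
  congr 1
  group

/-! ### The induced morphism of pullback algebroids and its inverse -/

section PullbackMap

variable {EG : Type*} [NormedAddCommGroup EG] [NormedSpace ℝ EG] [FiniteDimensional ℝ EG]
  {G : Type*} [TopologicalSpace G] [ChartedSpace EG G] [Group G] [LieGroup 𝓘(ℝ, EG) ∞ G]
  [SecondCountableTopology G]
  {EM : Type*} [NormedAddCommGroup EM] [NormedSpace ℝ EM] [FiniteDimensional ℝ EM]
  {M : Type*} [TopologicalSpace M] [ChartedSpace EM M] [IsManifold 𝓘(ℝ, EM) ∞ M] [T2Space M]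
  [MulAction G M] [ContMDiffSMul 𝓘(ℝ, EG) 𝓘(ℝ, EM) ∞ G M] [MulAction.IsPretransitive G M]
  {ES : Type*} [NormedAddCommGroup ES] [NormedSpace ℝ ES] [FiniteDimensional ℝ ES]
  {S : Type*} [TopologicalSpace S] [ChartedSpace ES S] [IsManifold 𝓘(ℝ, ES) ∞ S]
  {f₁ f₂ : C^∞⟮𝓘(ℝ, ES), S; 𝓘(ℝ, EM), M⟯} {φ : M ≃ₘ⟮𝓘(ℝ, EM), 𝓘(ℝ, EM)⟯ M} {l : G}

/-- This is what makes `(ξ, v) ↦ (Ad l ξ, v)` land in `A(f₂)`: with `(ξ, v)` in the fibre of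
`A(f₁)`, one has `Tf₂ v = Tφ (Tf₁ v) = Tφ (ξ†(f₁ x)) = (Ad l ξ)†(φ (f₁ x))`. The map `f₂` is kept as
a variable with a pointwise equation, instead of being replaced by `φ ∘ f₁`, so that the result
applies equally to `φ.symm` with the roles of `f₁` and `f₂` exchanged. -/
theorem IsSymmetryBy.pullback_compat (h : IsSymmetryBy l φ) (hf : ∀ x, f₂ x = φ (f₁ x)) (x : S)
    (p : PFib EG G f₁ x) :
    infGen EG G EM (f₂ x) (Ad l (gPart G f₁ x p)) =
      mfderiv 𝓘(ℝ, ES) 𝓘(ℝ, EM) f₂ x (tPart G f₁ x p) := by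
  have e : (f₂ : S → M) = φ ∘ f₁ := funext hf
  have h1 := mfderiv_comp_apply (I := 𝓘(ℝ, ES)) (I' := 𝓘(ℝ, EM)) (I'' := 𝓘(ℝ, EM)) x
    (φ.contMDiff.mdifferentiableAt (x := f₁ x) (by simp))
    (f₁.contMDiff.mdifferentiableAt (x := x) (by simp)) (tPart G f₁ x p)
  have h2 := mfderiv_infGen_of_conj_equivariant φ.contMDiff h (f₁ x) (gPart G f₁ x p)
  -- The defining equation of the fibre of `A(f₁)` turns `ξ†(f₁ x)` into `Tf₁ v`, which is where the
  -- chain rule for `φ ∘ f₁` takes over.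
  rw [infGen_gPart] at h2
  -- The points `f₂ x` and `φ (f₁ x)` are equal only through `hf`, so both sides are moved between
  -- these base points as elements of the model space `EM`.
  have c1 : (infGen EG G EM (f₂ x) (Ad l (gPart G f₁ x p)) : EM) =
      infGen EG G EM (φ (f₁ x)) (Ad l (gPart G f₁ x p)) :=
    congrArg (fun m => (infGen EG G EM m (Ad l (gPart G f₁ x p)) : EM)) (hf x)
  have c2 : (mfderiv 𝓘(ℝ, ES) 𝓘(ℝ, EM) f₂ x (tPart G f₁ x p) : EM) =
      mfderiv 𝓘(ℝ, ES) 𝓘(ℝ, EM) (φ ∘ f₁) x (tPart G f₁ x p) :=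
    congrArg (fun k : S → M => (mfderiv 𝓘(ℝ, ES) 𝓘(ℝ, EM) k x (tPart G f₁ x p) : EM)) e
  exact c1.trans (h2.symm.trans (h1.symm.trans c2.symm))

/-- The map `A(f₁) → A(φ ∘ f₁)`, `(ξ, v) ↦ (Ad_l ξ, v)`, on fibres. -/
noncomputable def IsSymmetryBy.pullbackFib (h : IsSymmetryBy l φ) (hf : ∀ x, f₂ x = φ (f₁ x))
    (x : S) : PFib EG G f₁ x →ₗ[ℝ] PFib EG G f₂ x where
  toFun p := ⟨(Ad l (gPart G f₁ x p), tPart G f₁ x p), h.pullback_compat hf x p⟩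
  map_add' p q := pfib_ext
    ((congrArg (Ad l) (map_add (gPart G f₁ x) p q)).trans (map_add (Ad l) _ _))
    (map_add (tPart G f₁ x) p q)
  map_smul' c p := pfib_ext
    ((congrArg (Ad l) (map_smul (gPart G f₁ x) c p)).trans (map_smul (Ad l) _ _))
    (map_smul (tPart G f₁ x) c p)

/-- In the Lie algebra component, `Ad l` commutes with differentiation along vector fields because
it is linear and does not depend on the point, and with `{X, Y}` because it is an automorphism. In
the tangent component nothing has changed. The sections `X'` and `Y'` are arbitrary ones satisfying
pointwise equations, the form required of a morphism of Lie algebroids. -/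
theorem IsSymmetryBy.pullbackBracket_pullbackFib (h : IsSymmetryBy l φ)
    (hf : ∀ x, f₂ x = φ (f₁ x)) (X Y : Cₛ^∞⟮𝓘(ℝ, ES); PModel EG EM ES, PFib EG G f₁⟯)
    (X' Y' : Cₛ^∞⟮𝓘(ℝ, ES); PModel EG EM ES, PFib EG G f₂⟯)
    (hX : ∀ x, X' x = h.pullbackFib hf x (X x)) (hY : ∀ x, Y' x = h.pullbackFib hf x (Y x))
    (x : S) : pullbackBracket X' Y' x = h.pullbackFib hf x (pullbackBracket X Y x) := by
  -- The components are matched as functions on all of `S`, since the bracket differentiates them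
  -- and values at `x` alone would not suffice.
  have hgX : (fun y => gPart G f₂ y (X' y)) = fun y => Ad l (gPart G f₁ y (X y)) :=
    funext fun y => congrArg (gPart G f₂ y) (hX y)
  have hgY : (fun y => gPart G f₂ y (Y' y)) = fun y => Ad l (gPart G f₁ y (Y y)) :=
    funext fun y => congrArg (gPart G f₂ y) (hY y)
  have htX : (fun y => tPart G f₂ y (X' y)) = fun y => tPart G f₁ y (X y) :=
    funext fun y => congrArg (tPart G f₂ y) (hX y)
  have htY : (fun y => tPart G f₂ y (Y' y)) = fun y => tPart G f₁ y (Y y) :=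
    funext fun y => congrArg (tPart G f₂ y) (hY y)
  refine pfib_ext ((gPart_bracket X' Y' x).trans ?_) ((tPart_bracket X' Y' x).trans ?_)
  · rw [hgX, hgY, htX, htY]
    have d1 := mvfderiv_clm_comp (Ad l)
      ((contMDiff_gPart X).mdifferentiableAt (x := x) (by simp)) (tPart G f₁ x (Y x))
    have d2 := mvfderiv_clm_comp (Ad l)
      ((contMDiff_gPart Y).mdifferentiableAt (x := x) (by simp)) (tPart G f₁ x (X x))
    -- The order follows the bracket formula: the second section is differentiated along the first
    -- with a plus sign, then the first along the second with a minus sign. Each term now carries an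
    -- `Ad l`, and linearity collects them into one.
    refine (congrArg₂ (· + ·) (congrArg₂ (· - ·) d2 d1) (bracketR_Ad l _ _)).trans ?_
    exact ((congrArg (· + _) (map_sub (Ad l) _ _).symm).trans (map_add (Ad l) _ _).symm)
  · rw [htX, htY]
    rfl

variable (EG) in
/-- The Lie algebroid morphism `A(f₁) → A(φ ∘ f₁)` induced by `Ad_l × φ`. -/
noncomputable def IsSymmetryBy.pullbackHom (h : IsSymmetryBy l φ) (hf : ∀ x, f₂ x = φ (f₁ x)) :
    LieAlgebroid.Hom (pullbackAlgebroid (EG := EG) G f₁) (pullbackAlgebroid (EG := EG) G f₂) where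
  toFun := h.pullbackFib hf
  smooth := by
    -- Smoothness into a pullback algebroid is tested on its two components. Applied to the identity
    -- of the total space of `A(f₁)`, the test says that both projections are smooth; the same test
    -- for `A(f₂)` then asks only that the first stay smooth after composing with the constant
    -- operator `Ad l`.
    have hid := (contMDiff_pullback_iff (EG := EG) G f₁ _).1 contMDiff_id
    exact (contMDiff_pullback_iff (EG := EG) G f₂ _).2
      ⟨(contMDiff_const (c := Ad l)).clm_apply hid.1, hid.2⟩
  anchor_toFun _ _ := rfl
  bracket_toFun := h.pullbackBracket_pullbackFib hf

variable [Nonempty S]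

variable (EG) in
/-- The isomorphism `δf₁ ≅ δ(φ ∘ f₁)` induced by `Ad_l × φ`. -/
noncomputable def IsSymmetryBy.logarithmicDerivativeIso (h : IsSymmetryBy l φ)
    (hf : ∀ x, f₂ x = φ (f₁ x)) :
    logarithmicDerivative EG G f₁ ≅ logarithmicDerivative EG G f₂ where
  hom := MCForm.Hom.mk (h.pullbackHom EG hf) l fun _ _ => rfl
  -- The same construction is run for `φ.symm` and `l⁻¹`, using that `f₁` is `φ.symm` composed with
  -- `f₂`.
  inv := MCForm.Hom.mk (h.symm.pullbackHom EG fun x => by rw [hf, φ.symm_apply_apply]) l⁻¹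
    fun _ _ => rfl
  -- Composition of morphisms multiplies the group elements with the later one on the left, giving
  -- `l⁻¹ * l`. On fibres the Lie algebra component is `Ad l⁻¹` after `Ad l`, which is `Ad 1`, while
  -- the tangent component is unchanged definitionally. The other composite is symmetric.
  hom_inv_id := by
    refine MCForm.Hom.ext (LieAlgebroid.Hom.ext fun x => LinearMap.ext fun p => ?_)
      (inv_mul_cancel l)
    refine pfib_ext ((Ad_mul l⁻¹ l (gPart G f₁ x p)).symm.trans ?_) rfl
    rw [inv_mul_cancel]
    exact Ad_one _
  inv_hom_id := by
    refine MCForm.Hom.ext (LieAlgebroid.Hom.ext fun x => LinearMap.ext fun p => ?_)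
      (mul_inv_cancel l)
    refine pfib_ext ((Ad_mul l l⁻¹ (gPart G f₂ x p)).symm.trans ?_) rfl
    rw [mul_inv_cancel]
    exact Ad_one _

end PullbackMap

/-! ### The isomorphism of logarithmic derivatives -/

theorem proposition2p5
    {EG : Type*} [NormedAddCommGroup EG] [NormedSpace ℝ EG] [FiniteDimensional ℝ EG]
    {G : Type*} [TopologicalSpace G] [ChartedSpace EG G] [Group G] [LieGroup 𝓘(ℝ, EG) ∞ G]
    [T2Space G] [SecondCountableTopology G]
    {EM : Type*} [NormedAddCommGroup EM] [NormedSpace ℝ EM] [FiniteDimensional ℝ EM]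
    {M : Type*} [TopologicalSpace M] [ChartedSpace EM M] [IsManifold 𝓘(ℝ, EM) ∞ M]
    [T2Space M] [SecondCountableTopology M]
    [MulAction G M] [ContMDiffSMul 𝓘(ℝ, EG) 𝓘(ℝ, EM) ∞ G M] [MulAction.IsPretransitive G M]
    {ES : Type*} [NormedAddCommGroup ES] [NormedSpace ℝ ES] [FiniteDimensional ℝ ES]
    {S : Type*} [TopologicalSpace S] [ChartedSpace ES S] [IsManifold 𝓘(ℝ, ES) ∞ S]
    [T2Space S] [SecondCountableTopology S] [ConnectedSpace S]
    (f₁ f₂ : C^∞⟮𝓘(ℝ, ES), S; 𝓘(ℝ, EM), M⟯)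
    (φ : M ≃ₘ⟮𝓘(ℝ, EM), 𝓘(ℝ, EM)⟯ M) (hφ : IsSymmetry G φ)
    (hf₂ : ∀ x, f₂ x = φ (f₁ x)) :
    Nonempty (logarithmicDerivative EG G f₁ ≅ logarithmicDerivative EG G f₂) ∧
    ∀ l : G, IsSymmetryBy l φ →
      ∃ e : logarithmicDerivative EG G f₁ ≅ logarithmicDerivative EG G f₂,
        e.hom.l = l ∧
        ∀ (x : S) (a : (logarithmicDerivative EG G f₁).alg.Fib x),
          toAction EG G f₂ x (e.hom.map.toFun x a) =
            Prod.map (Ad l) φ (toAction EG G f₁ x a) := by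
  -- One construction serves both claims: any `l` witnessing that `φ` is a symmetry gives an
  -- isomorphism with that very `l` as its group component, and the first claim picks one such
  -- witness.
  refine ⟨?_, fun l hl => ⟨hl.logarithmicDerivativeIso EG hf₂, rfl, fun x a => ?_⟩⟩
  · obtain ⟨l, hl⟩ := hφ
    exact ⟨hl.logarithmicDerivativeIso EG hf₂⟩
  -- The Lie algebra components agree by construction; in the `M` component the intertwining
  -- condition is the relation between `f₂` and `f₁`.
  · exact Prod.ext rfl (hf₂ x)
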